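/- Let $N\in\{2,3\}$, let $\Omega\subset\mathbb R^N$ be open and bounded with $C^{1,1}$-boundary $\Gamma$, let $0<T<\infty$, $\Omega_T=\Omega\times(0,T)$, $\Sigma_T=\Gamma\times(0,T)$, $\overline\Omega_T=\overline\Omega\times[0,T]$, and let $r>N/2+1$, $s>N+1$, with conjugate exponents $r',s'$. Let $\alpha,\beta>0$, $y_0\in C(\overline\Omega)$, $y_d\in L^2(\Omega)$, $\psi\in C(\overline\Omega_T)$, $u_a<u_b$ a.e. in $L^r(\Omega_T)$, $v_a<v_b$ a.e. in $L^s(\Sigma_T)$, and $Ay=-\sum_{i,j}\partial_{x_j}(a_{ij}\partial_{x_i}y)$ with $a_{ij}=a_{ji}\in L^\infty(\Omega)$ uniformly elliptic, with conormal derivative $\partial_{\nu_A}y=\sum_{i,j}a_{ij}\,\partial_{x_i}y\,\nu_j$. Put $\mathcal U_{ad}=\{u\in L^r(\Omega_T): u_a\le u\le u_b \text{ a.e.}\}$, $\mathcal V_{ad}=\{v\in L^s(\Sigma_T): v_a\le v\le v_b\text{ a.e.}\}$ and $W(0,T)=\{y\in L^2(0,T;H^1(\Omega)) : y_t\in L^2(0,T;H^1(\Omega)^*)\}$.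 Write $(z)_+=\max(z,0)$. Let $\mathcal M(\overline\Omega_T)=C(\overline\Omega_T)^*$ with the dual norm and the pairing $\langle\cdot,\cdot\rangle$. For $f\in L^r(\Omega_T)$, $g\in L^s(\Sigma_T)$, $\eta\in C(\overline\Omega)$, a *state* with data $(f,g,\eta)$ is a function $y\in W(0,T)\cap C(\overline\Omega_T)$ with $y(\cdot,0)=\eta$ on $\overline\Omega$ and $$\int_0^T\langle y_t,w\rangle\,dt+\int_{\Omega_T}\sum_{i,j}a_{ij}\,\partial_{x_i}y\,\partial_{x_j}w\,dx\,dt-\int_{\Sigma_T}g\,w\,dS\,dt=\int_{\Omega_T}f\,w\,dx\,dt\qquad\forall w\in L^2(0,T;H^1(\Omega)).$$ (a) Let $(\bar y,\bar u,\bar v,\bar\mu)$ solve the optimality system of the state-constrained problem: $\bar u\in\mathcal U_{ad}$, $\bar v\in\mathcal V_{ad}$; $\bar y$ is the state with data $(\bar u,\bar v,y_0)$; $\bar y\le\psi$ in $\Omega_T$; $\bar\mu\in\mathcal M(\overline\Omega_T)$, $\bar\mu\ge0$, $\langle\bar\mu,\bar y-\psi\rangle=0$; and there is an adjoint state $\bar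 p$ with $$\int_{\Omega_T}(\bar p+\alpha\bar u)(u-\bar u)\,dx\,dt\ge0\ \ \forall u\in\mathcal U_{ad},\qquad \int_{\Sigma_T}(\bar p+\beta\bar v)(v-\bar v)\,dS\,dt\ge0\ \ \forall v\in\mathcal V_{ad}.$$ Here $\bar p\in L^1(0,T;W^{1,q}(\Omega))$ for some $1<q<N/(N-1)$, with $\bar p\in L^{r'}(\Omega_T)$ and trace $\bar p|_{\Sigma_T}\in L^{s'}(\Sigma_T)$, solves $-\bar p_t+A\bar p=\bar\mu|_{\Omega_T}$ in $\Omega_T$, $\partial_{\nu_A}\bar p=\bar\mu|_{\Sigma_T}$ on $\Sigma_T$, $\bar p(\cdot,T)=\bar y(\cdot,T)-y_d$, in the following sense: for every $C^1$ function $\varphi$ on $\mathbb R^N\times\mathbb R$ with $\varphi(\cdot,0)=0$ on $\overline\Omega$, $$\int_{\Omega_T}\Big(\bar p\,\varphi_t+\sum_{i,j}a_{ij}\,\partial_{x_i}\bar p\,\partial_{x_j}\varphi\Big)dx\,dt=\langle\bar\mu,\varphi\rangle+\int_\Omega(\bar y(T)-y_d)\,\varphi(T)\,dx,$$ and Green's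 formula $$\int_{\Omega_T}\bar p\,f\,dx\,dt+\int_{\Sigma_T}\bar p\,g\,dS\,dt=\langle\bar\mu,z\rangle+\int_\Omega(\bar y(T)-y_d)\,z(T)\,dx$$ holds for every state $z$ with data $(f,g,0)$, $f\in L^r(\Omega_T)$, $g\in L^s(\Sigma_T)$. (b) Let $\rho_k>0$, let $\mu_k\in L^2(\Omega_T)$ with $\mu_k\ge0$, and let $(\bar y_k,\bar u_k,\bar v_k,\bar\mu_k)$ solve the optimality system of the augmented Lagrange subproblem: $\bar u_k\in\mathcal U_{ad}$, $\bar v_k\in\mathcal V_{ad}$; $\bar y_k$ is the state with data $(\bar u_k,\bar v_k,y_0)$; $\bar\mu_k=(\rho_k(\bar y_k-\psi)+\mu_k)_+$; and there is $\bar p_k\in W(0,T)$, the weak solution of $-(\bar p_k)_t+A\bar p_k=\bar\mu_k$ in $\Omega_T$, $\partial_{\nu_A}\bar p_k=0$ on $\Sigma_T$, $\bar p_k(\cdot,T)=\bar y_k(\cdot,T)-y_d$ in $L^2(\Omega)$, such that $$\int_{\Omega_T}(\bar p_k+\alpha\bar u_k)(u-\bar u_k)\,dx\,dt\ge0\ \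 \forall u\in\mathcal U_{ad},\qquad \int_{\Sigma_T}(\bar p_k+\beta\bar v_k)(v-\bar v_k)\,dS\,dt\ge0\ \ \forall v\in\mathcal V_{ad}.$$ Then $\bar u-\bar u_k\in L^2(\Omega_T)$, $\bar v-\bar v_k\in L^2(\Sigma_T)$, and $$\alpha\|\bar u-\bar u_k\|_{L^2(\Omega_T)}^2+\beta\|\bar v-\bar v_k\|_{L^2(\Sigma_T)}^2\le\|\bar\mu\|_{\mathcal M(\overline\Omega_T)}\,\|(\bar y_k-\psi)_+\|_{C(\overline\Omega_T)}+\Big|\int_0^T(\bar\mu_k,\psi-\bar y_k)_{L^2(\Omega)}\,dt\Big|.$$ -/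

import Mathlib

open MeasureTheory Set Filter Topology
open scoped ENNReal ContDiff

noncomputable section

namespace ParabolicControl

/-- `ℝ^N` with the Euclidean norm. -/
abbrev E (N : ℕ) := EuclideanSpace ℝ (Fin N)

/-! ### Sobolev spaces on an open set -/

/-- `G` is the weak gradient of `f` on the open set `Ω`. -/
def HasWeakGrad {N : ℕ} (Ω : Set (E N)) (f : E N → ℝ) (G : E N → E N) : Prop :=
  ∀ φ : E N → ℝ, ContDiff ℝ ∞ φ → HasCompactSupport φ → tsupport φ ⊆ Ω → ∀ i : Fin N,
    ∫ x in Ω, f x * fderiv ℝ φ x (EuclideanSpace.single i 1) = - ∫ x in Ω, G x i * φ x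

lemma integrable_mul_test {N : ℕ} {Ω : Set (E N)} {q : ℝ≥0∞} [hq : Fact (1 ≤ q)]
    {f φ : E N → ℝ} (hf : MemLp f q (volume.restrict Ω)) (hφ : Continuous φ)
    (hc : HasCompactSupport φ) : Integrable (fun x => f x * φ x) (volume.restrict Ω) := by
  have := (hf.locallyIntegrable hq.out).integrable_smul_left_of_hasCompactSupport hφ hc
  simpa [mul_comm] using this

/-- The Sobolev space `W^{1,q}(Ω)`: pairs (function, weak gradient) in `L^q(Ω) × L^q(Ω)^N`, with
the norm `(‖f‖^q + ‖∇f‖^q)^{1/q}`. -/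
def Sobolev {N : ℕ} (q : ℝ≥0∞) [hq : Fact (1 ≤ q)] (Ω : Set (E N)) :
    Submodule ℝ (WithLp q (Lp ℝ q (volume.restrict Ω) × Lp (E N) q (volume.restrict Ω))) where
  carrier := {f | HasWeakGrad Ω f.fst f.snd}
  zero_mem' := by
    intro φ _ _ _ i
    have h1 := Lp.coeFn_zero ℝ q (volume.restrict Ω)
    have h2 := Lp.coeFn_zero (E N) q (volume.restrict Ω)
    have e1 : ∫ x in Ω, (0 : Lp ℝ q (volume.restrict Ω)) x *
        fderiv ℝ φ x (EuclideanSpace.single i 1) = 0 := by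
      refine integral_eq_zero_of_ae ?_
      filter_upwards [h1] with x hx
      rw [hx]; simp
    have e2 : ∫ x in Ω, (0 : Lp (E N) q (volume.restrict Ω)) x i * φ x = 0 := by
      refine integral_eq_zero_of_ae ?_
      filter_upwards [h2] with x hx
      rw [hx]; simp
    rw [WithLp.zero_fst, WithLp.zero_snd, e1, e2, neg_zero]
  add_mem' := by
    intro f g hf hg φ hφ hc hs i
    have hd : Continuous fun x => fderiv ℝ φ x (EuclideanSpace.single i 1) :=
      (hφ.continuous_fderiv (by simp)).clm_apply continuous_const
    have hdc : HasCompactSupport fun x => fderiv ℝ φ x (EuclideanSpace.single i 1) :=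
      hc.fderiv_apply (𝕜 := ℝ) _
    have key : ∀ h : Lp (E N) q (volume.restrict Ω),
        MemLp (fun x => h x i) q (volume.restrict Ω) := fun h =>
      (EuclideanSpace.proj i : E N →L[ℝ] ℝ).comp_memLp' (Lp.memLp h)
    have e1 : ∫ x in Ω, (f + g).fst x * fderiv ℝ φ x (EuclideanSpace.single i 1) =
        (∫ x in Ω, f.fst x * fderiv ℝ φ x (EuclideanSpace.single i 1)) +
          ∫ x in Ω, g.fst x * fderiv ℝ φ x (EuclideanSpace.single i 1) := by
      rw [← integral_add (integrable_mul_test (Lp.memLp f.fst) hd hdc)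
        (integrable_mul_test (Lp.memLp g.fst) hd hdc)]
      refine integral_congr_ae ?_
      filter_upwards [Lp.coeFn_add f.fst g.fst] with x hx
      rw [WithLp.add_fst, hx, Pi.add_apply]; ring
    have e2 : ∫ x in Ω, (f + g).snd x i * φ x =
        (∫ x in Ω, f.snd x i * φ x) + ∫ x in Ω, g.snd x i * φ x := by
      rw [← integral_add (integrable_mul_test (key f.snd) hφ.continuous hc)
        (integrable_mul_test (key g.snd) hφ.continuous hc)]
      refine integral_congr_ae ?_
      filter_upwards [Lp.coeFn_add f.snd g.snd] with x hx
      rw [WithLp.add_snd, hx, Pi.add_apply, PiLp.add_apply]; ring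
    rw [e1, e2, hf φ hφ hc hs i, hg φ hφ hc hs i]; ring
  smul_mem' := by
    intro c f hf φ hφ hc hs i
    have e1 : ∫ x in Ω, (c • f).fst x * fderiv ℝ φ x (EuclideanSpace.single i 1) =
        c * ∫ x in Ω, f.fst x * fderiv ℝ φ x (EuclideanSpace.single i 1) := by
      rw [← integral_const_mul]
      refine integral_congr_ae ?_
      filter_upwards [Lp.coeFn_smul c f.fst] with x hx
      rw [WithLp.smul_fst, hx, Pi.smul_apply, smul_eq_mul]; ring
    have e2 : ∫ x in Ω, (c • f).snd x i * φ x = c * ∫ x in Ω, f.snd x i * φ x := by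
      rw [← integral_const_mul]
      refine integral_congr_ae ?_
      filter_upwards [Lp.coeFn_smul c f.snd] with x hx
      rw [WithLp.smul_snd, hx, Pi.smul_apply, PiLp.smul_apply, smul_eq_mul]; ring
    rw [e1, e2, hf φ hφ hc hs i]; ring

/-- The function underlying an element of `W^{1,q}(Ω)`. -/
def val {N : ℕ} {q : ℝ≥0∞} [Fact (1 ≤ q)] {Ω : Set (E N)} (f : Sobolev q Ω) :
    Lp ℝ q (volume.restrict Ω) := f.1.fst

/-- The weak gradient of an element of `W^{1,q}(Ω)`. -/
def grad {N : ℕ} {q : ℝ≥0∞} [Fact (1 ≤ q)] {Ω : Set (E N)} (f : Sobolev q Ω) :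
    Lp (E N) q (volume.restrict Ω) := f.1.snd

/-- The Hilbert space `H¹(Ω) = W^{1,2}(Ω)`. -/
abbrev H1 {N : ℕ} (Ω : Set (E N)) := Sobolev 2 Ω

/-- Surface measure on the boundary of `Ω`: the `(N-1)`-dimensional Hausdorff measure, normalised
so that it is Lebesgue measure on hyperplanes. -/
def surface {N : ℕ} (Ω : Set (E N)) : Measure (E N) :=
  (Measure.euclideanHausdorffMeasure (N - 1)).restrict (frontier Ω)

/-- `h` is the boundary trace of `f ∈ W^{1,q}(Ω)`: some sequence of smooth functions on `ℝ^N`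
converges to `f` in `W^{1,q}(Ω)` and its restrictions to `∂Ω` converge to `h` in `L^q(∂Ω)`. -/
def IsTrace {N : ℕ} {q : ℝ≥0∞} [Fact (1 ≤ q)] {Ω : Set (E N)} (f : Sobolev q Ω)
    (h : E N → ℝ) : Prop :=
  ∃ φ : ℕ → E N → ℝ, (∀ n, ContDiff ℝ ∞ (φ n)) ∧
    Tendsto (fun n => eLpNorm (fun x => φ n x - val f x) q (volume.restrict Ω)) atTop (𝓝 0) ∧
    Tendsto (fun n => eLpNorm (fun x => gradient (φ n) x - grad f x) q (volume.restrict Ω))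
      atTop (𝓝 0) ∧
    Tendsto (fun n => eLpNorm (fun x => φ n x - h x) q (surface Ω)) atTop (𝓝 0)

/-- The boundary of `Ω` is of class `C^{1,1}`: near each boundary point, and for a suitable unit
vector `e`, the set `Ω` is the region above the graph, over the hyperplane orthogonal to `e`, of a
`C¹` function with Lipschitz continuous derivative. -/
def HasC11Boundary {N : ℕ} (Ω : Set (E N)) : Prop :=
  ∀ x₀ ∈ frontier Ω, ∃ (ε : ℝ) (e : E N) (γ : (ℝ ∙ e)ᗮ → ℝ) (L : NNReal),
    0 < ε ∧ ‖e‖ = 1 ∧ ContDiff ℝ 1 γ ∧ LipschitzWith L (fderiv ℝ γ) ∧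
    ∀ x ∈ Metric.ball x₀ ε, x ∈ Ω ↔ γ ((ℝ ∙ e)ᗮ.orthogonalProjectionOnto x) < inner ℝ e x

/-! ### Time dependent functions -/

/-- `g : (0,T) → H¹(Ω)*` is the weak time derivative of `Y : (0,T) → H¹(Ω)`, with `H¹(Ω)` embedded
in `H¹(Ω)*` through the inner product of `L²(Ω)`. -/
def IsTimeDeriv {N : ℕ} {Ω : Set (E N)} (T : ℝ) (Y : ℝ → H1 Ω) (g : ℝ → StrongDual ℝ (H1 Ω)) :
    Prop :=
  ∀ φ : ℝ → ℝ, ContDiff ℝ ∞ φ → HasCompactSupport φ → tsupport φ ⊆ Ioo 0 T → ∀ η : H1 Ω,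
    ∫ t in Ioo 0 T, deriv φ t * inner ℝ (val (Y t)) (val η) = - ∫ t in Ioo 0 T, φ t * g t η

/-- `Y ∈ L^a(0,T; W^{1,q}(Ω))`, and `y` is the same function written as a function of `(x,t)`. -/
def MemBochner {N : ℕ} {Ω : Set (E N)} {q : ℝ≥0∞} [Fact (1 ≤ q)] (T : ℝ) (a : ℝ≥0∞)
    (Y : ℝ → Sobolev q Ω) (y : E N × ℝ → ℝ) : Prop :=
  MemLp Y a (volume.restrict (Ioo 0 T)) ∧
    AEStronglyMeasurable y (volume.restrict (Ω ×ˢ Ioo 0 T)) ∧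
    ∀ᵐ t ∂volume.restrict (Ioo 0 T), ⇑(val (Y t)) =ᵐ[volume.restrict Ω] fun x => y (x, t)

/-- `yΓ`, a function on `∂Ω × (0,T)`, is the boundary trace of `Y` at almost every time. -/
def IsLateralTrace {N : ℕ} {Ω : Set (E N)} {q : ℝ≥0∞} [Fact (1 ≤ q)] (T : ℝ)
    (Y : ℝ → Sobolev q Ω) (yΓ : E N × ℝ → ℝ) : Prop :=
  ∀ᵐ t ∂volume.restrict (Ioo 0 T), IsTrace (Y t) fun x => yΓ (x, t)

/-! ### The data of the control problem -/

/-- The closed space-time cylinder. -/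
abbrev cyl {N : ℕ} (Ω : Set (E N)) (T : ℝ) : Set (E N × ℝ) := closure Ω ×ˢ Icc 0 T

/-- The data of the control problem and the standing assumptions on them. -/
structure Data (N : ℕ) where
  dim : N = 2 ∨ N = 3
  Ω : Set (E N)
  isOpen : IsOpen Ω
  bounded : Bornology.IsBounded Ω
  boundary : HasC11Boundary Ω
  T : ℝ
  T_pos : 0 < T
  r : ℝ≥0∞
  s : ℝ≥0∞
  hr : (N : ℝ≥0∞) / 2 + 1 < r
  hs : (N : ℝ≥0∞) + 1 < s
  α : ℝ
  β : ℝ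
  α_pos : 0 < α
  β_pos : 0 < β
  y₀ : C(closure Ω, ℝ)
  yd : E N → ℝ
  yd_mem : MemLp yd 2 (volume.restrict Ω)
  ψ : C(cyl Ω T, ℝ)
  ua : E N × ℝ → ℝ
  ub : E N × ℝ → ℝ
  ua_mem : MemLp ua r (volume.restrict (Ω ×ˢ Ioo 0 T))
  ub_mem : MemLp ub r (volume.restrict (Ω ×ˢ Ioo 0 T))
  ua_lt_ub : ∀ᵐ z ∂volume.restrict (Ω ×ˢ Ioo 0 T), ua z < ub z
  va : E N × ℝ → ℝ
  vb : E N × ℝ → ℝ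
  va_mem : MemLp va s ((surface Ω).prod (volume.restrict (Ioo 0 T)))
  vb_mem : MemLp vb s ((surface Ω).prod (volume.restrict (Ioo 0 T)))
  va_lt_vb : ∀ᵐ z ∂(surface Ω).prod (volume.restrict (Ioo 0 T)), va z < vb z
  a : Fin N → Fin N → E N → ℝ
  a_mem : ∀ i j, MemLp (a i j) ∞ (volume.restrict Ω)
  a_symm : ∀ i j, ∀ᵐ x ∂volume.restrict Ω, a i j x = a j i x
  elliptic : ∃ θ > 0, ∀ᵐ x ∂volume.restrict Ω, ∀ ξ : E N,
    θ * ‖ξ‖ ^ 2 ≤ ∑ i, ∑ j, a i j x * ξ i * ξ j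

namespace Data

variable {N : ℕ} (D : Data N)

/-- The closed cylinder, whose space of continuous functions is `C(Ω̄_T)`. -/
abbrev K : Set (E N × ℝ) := cyl D.Ω D.T

instance : CompactSpace D.K :=
  isCompact_iff_compactSpace.mp (D.bounded.isCompact_closure.prod isCompact_Icc)

/-- Lebesgue measure on `Ω_T = Ω × (0,T)`. -/
abbrev muInt : Measure (E N × ℝ) := volume.restrict (D.Ω ×ˢ Ioo 0 D.T)

/-- Surface measure on `Σ_T = ∂Ω × (0,T)`. -/
abbrev muLat : Measure (E N × ℝ) := (surface D.Ω).prod (volume.restrict (Ioo 0 D.T))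

/-- A function in `C(Ω̄_T)`, extended by zero. -/
def ext (y : C(D.K, ℝ)) : E N × ℝ → ℝ := Function.extend Subtype.val y 0

/-- Restriction to `Ω̄_T` of a continuous function. -/
def res (φ : E N × ℝ → ℝ) (hφ : Continuous φ) : C(D.K, ℝ) := ⟨fun z => φ z, by fun_prop⟩

/-- The bilinear form `∫_Ω ∑ a_ij ∂_i f ∂_j g dx`, as a function of the two gradients. -/
def form (F G : E N → E N) : ℝ := ∫ x in D.Ω, ∑ i, ∑ j, D.a i j x * F x i * G x j

def Uad : Set (E N × ℝ → ℝ) :=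
  {u | MemLp u D.r D.muInt ∧ ∀ᵐ z ∂D.muInt, D.ua z ≤ u z ∧ u z ≤ D.ub z}

def Vad : Set (E N × ℝ → ℝ) :=
  {v | MemLp v D.s D.muLat ∧ ∀ᵐ z ∂D.muLat, D.va z ≤ v z ∧ v z ≤ D.vb z}

/-- `y ∈ W(0,T; L²(Ω), H¹(Ω)) ∩ C(Ω̄_T)` is the weak solution of
`y_t + A y = u` in `Ω_T`, `∂_{ν_A} y = v` on `Σ_T`, `y(·,0) = η` on `Ω̄`. -/
def IsState (u v : E N × ℝ → ℝ) (η : closure D.Ω → ℝ) (y : C(D.K, ℝ)) : Prop :=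
  (∃ (Y : ℝ → H1 D.Ω) (Y' : ℝ → StrongDual ℝ (H1 D.Ω)),
    MemBochner D.T 2 Y (D.ext y) ∧
    MemLp Y' 2 (volume.restrict (Ioo 0 D.T)) ∧ IsTimeDeriv D.T Y Y' ∧
    ∀ (W : ℝ → H1 D.Ω) (w wΓ : E N × ℝ → ℝ), MemBochner D.T 2 W w →
      MemLp wΓ 2 D.muLat → IsLateralTrace D.T W wΓ →
      (∫ t in Ioo 0 D.T, Y' t (W t)) - (∫ z, v z * wΓ z ∂D.muLat)
        + (∫ t in Ioo 0 D.T, D.form (grad (Y t)) (grad (W t))) = ∫ z, u z * w z ∂D.muInt) ∧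
  ∀ (x : E N) (hx : x ∈ closure D.Ω), y ⟨(x, 0), hx, le_rfl, D.T_pos.le⟩ = η ⟨x, hx⟩

/-- `p ∈ W(0,T; L²(Ω), H¹(Ω))`, with trace `pΓ` on `Σ_T`, is the weak solution of
`-p_t + A p = m` in `Ω_T`, `∂_{ν_A} p = 0` on `Σ_T`, `p(·,T) = pT` on `Ω`, for a function `m`. The
value at time `T` is that of the representative of `p` in `C([0,T]; L²(Ω))`. -/
def IsAdjoint (m : E N × ℝ → ℝ) (pT : E N → ℝ) (p pΓ : E N × ℝ → ℝ) : Prop :=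
  ∃ (P : ℝ → H1 D.Ω) (P' : ℝ → StrongDual ℝ (H1 D.Ω)),
    MemBochner D.T 2 P p ∧ MemLp pΓ 2 D.muLat ∧ IsLateralTrace D.T P pΓ ∧
    MemLp P' 2 (volume.restrict (Ioo 0 D.T)) ∧ IsTimeDeriv D.T P P' ∧
    (∀ (W : ℝ → H1 D.Ω) (w : E N × ℝ → ℝ), MemBochner D.T 2 W w →
      - (∫ t in Ioo 0 D.T, P' t (W t)) + (∫ t in Ioo 0 D.T, D.form (grad (P t)) (grad (W t)))
        = ∫ z, m z * w z ∂D.muInt) ∧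
    ∃ c : ℝ → Lp ℝ 2 (volume.restrict D.Ω), ContinuousOn c (Icc 0 D.T) ∧
      (∀ᵐ t ∂volume.restrict (Ioo 0 D.T), c t = val (P t)) ∧ ⇑(c D.T) =ᵐ[volume.restrict D.Ω] pT

/-- `p ∈ L¹(0,T; W^{1,q}(Ω))`, `1 < q < N/(N-1)`, with trace `pΓ` on `Σ_T`, is the solution of
`-p_t + A p = μ` in `Ω_T`, `∂_{ν_A} p = μ` on `Σ_T`, `p(·,T) = pT` on `Ω`, for a measure
`μ ∈ C(Ω̄_T)*`: `p` and `pΓ` are integrable enough to be paired with controls, the weak formulation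
holds for `C¹` test functions that vanish at `t = 0`, and so does Green's formula (the equation in
the sense of transposition) for all states with zero initial value. The interior and the lateral
part of `μ` enter through the pairing of `μ` with the test function. Merely bounded coefficients
make Green's formula necessary: `C¹` test functions alone do not determine `p`. -/
def IsMeasureAdjoint (μ : StrongDual ℝ C(D.K, ℝ)) (pT : E N → ℝ) (p pΓ : E N × ℝ → ℝ) : Prop :=
  ∃ (q : ℝ≥0∞) (_ : Fact (1 ≤ q)), 1 < q ∧ q < (N : ℝ≥0∞) / ((N : ℝ≥0∞) - 1) ∧
    MemLp p D.r.conjExponent D.muInt ∧ MemLp pΓ D.s.conjExponent D.muLat ∧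
    (∃ P : ℝ → Sobolev q D.Ω, MemBochner D.T 1 P p ∧ IsLateralTrace D.T P pΓ ∧
      ∀ (φ : E N × ℝ → ℝ) (hφ : ContDiff ℝ 1 φ), (∀ x ∈ closure D.Ω, φ (x, 0) = 0) →
        (∫ z, p z * fderiv ℝ φ z (0, 1) ∂D.muInt)
          + (∫ t in Ioo 0 D.T, D.form (grad (P t)) (fun x => gradient (fun x' => φ (x', t)) x))
          = μ (D.res φ hφ.continuous) + ∫ x in D.Ω, pT x * φ (x, D.T)) ∧
    ∀ (f g : E N × ℝ → ℝ) (z : C(D.K, ℝ)), MemLp f D.r D.muInt → MemLp g D.s D.muLat →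
      D.IsState f g (fun _ => 0) z →
      (∫ ξ, p ξ * f ξ ∂D.muInt) + (∫ ξ, pΓ ξ * g ξ ∂D.muLat)
        = μ z + ∫ x in D.Ω, pT x * D.ext z (x, D.T)

/-- `(y,u,v,μ)` solves the optimality system of the state constrained problem. -/
structure SolvesKKT (y : C(D.K, ℝ)) (u v : E N × ℝ → ℝ) (μ : StrongDual ℝ C(D.K, ℝ)) : Prop where
  u_mem : u ∈ D.Uad
  v_mem : v ∈ D.Vad
  state : D.IsState u v D.y₀ y
  feasible : ∀ z : D.K, (z : E N × ℝ) ∈ D.Ω ×ˢ Ioo 0 D.T → y z ≤ D.ψ z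
  adjoint : ∃ p pΓ : E N × ℝ → ℝ,
    D.IsMeasureAdjoint μ (fun x => D.ext y (x, D.T) - D.yd x) p pΓ ∧
    (∀ u' ∈ D.Uad, 0 ≤ ∫ z, (p z + D.α * u z) * (u' z - u z) ∂D.muInt) ∧
    (∀ v' ∈ D.Vad, 0 ≤ ∫ z, (pΓ z + D.β * v z) * (v' z - v z) ∂D.muLat)
  complementarity : μ (y - D.ψ) = 0
  nonneg : ∀ φ : C(D.K, ℝ), 0 ≤ φ → 0 ≤ μ φ

/-- The multiplier `(ρ (y - ψ) + μ)₊` of the augmented Lagrange subproblem. -/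
def mult (ρ : ℝ) (μ : E N × ℝ → ℝ) (y : C(D.K, ℝ)) : E N × ℝ → ℝ :=
  fun z => max (ρ * (D.ext y z - D.ext D.ψ z) + μ z) 0

/-- `(y,u,v,m)` solves the optimality system of the augmented Lagrange subproblem with penalty
parameter `ρ` and multiplier `μ`. -/
structure SolvesAL (ρ : ℝ) (μ : E N × ℝ → ℝ) (y : C(D.K, ℝ)) (u v m : E N × ℝ → ℝ) : Prop where
  u_mem : u ∈ D.Uad
  v_mem : v ∈ D.Vad
  state : D.IsState u v D.y₀ y
  mult_eq : m =ᵐ[D.muInt] D.mult ρ μ y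
  adjoint : ∃ p pΓ : E N × ℝ → ℝ,
    D.IsAdjoint m (fun x => D.ext y (x, D.T) - D.yd x) p pΓ ∧
    (∀ u' ∈ D.Uad, 0 ≤ ∫ z, (p z + D.α * u z) * (u' z - u z) ∂D.muInt) ∧
    (∀ v' ∈ D.Vad, 0 ≤ ∫ z, (pΓ z + D.β * v z) * (v' z - v z) ∂D.muLat)

end Data

end ParabolicControl

end

noncomputable section

namespace ParabolicControl

/-! ### The boundary of a `C^{1,1}` domain has finite surface measure -/

/-! Test each problem's variational inequality with the other problem's control and add. The left
side of the estimate is then at most `∫ (pk - p)(u - uk) + ∫ (pkΓ - pΓ)(v - vk)`. By linearity `z =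
y - yk` is a state with data `(u - uk, v - vk, 0)`, so duality with the two adjoint states turns
this bound into `∫ mk z - μ(z) + ∫ (yk(T) - y(T)) z(T)`. The terminal term is `-‖z(T)‖²`.
Complementarity and positivity give `-μ(z) = μ(yk - ψ) ≤ ‖μ‖ ‖(yk - ψ)₊‖`. Since `y ≤ ψ` and `mk ≥
0`, also `∫ mk z ≤ ∫ mk (ψ - yk)`.

For `p` the duality is the Green formula contained in `IsMeasureAdjoint`. For `pk` it has to be
proved (`IsAdjoint.integral_eq`): test the state equation with `pk` and the adjoint equation with
`z`; the elliptic terms cancel by symmetry, and the time derivatives combine through integration by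
parts in `W(0,T)`.

That formula, `inner_sub_inner_eq_integral_add`, carries most of the work. It is obtained from
difference quotients and the continuity of translations in `L²(ℝ)`, without approximation by smooth
functions. The other analytic input is the finite surface measure of the boundary, which places the
controls in `L²`. -/

lemma hausdorffMeasure_lt_top_iff_euclidean {X : Type*} [EMetricSpace X] [MeasurableSpace X]
    [BorelSpace X] (d : ℕ) (s : Set X) :
    Measure.euclideanHausdorffMeasure d s < ⊤ ↔ Measure.hausdorffMeasure (d : ℝ) s < ⊤ := by
  rw [Measure.euclideanHausdorffMeasure_def, Measure.smul_apply, ENNReal.smul_def, smul_eq_mul]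
  have h0 := Measure.addHaarScalarFactor_volume_hausdorffMeasure_ne_zero d
  constructor
  · intro h
    by_contra h'
    rw [not_lt, top_le_iff] at h'
    rw [h', ENNReal.mul_top (by exact_mod_cast h0)] at h
    exact lt_irrefl _ h
  · exact fun h => ENNReal.mul_lt_top ENNReal.coe_lt_top h

/-- The surface measure of a graph of a `C¹` function over a bounded piece of a hyperplane. -/
lemma hausdorffMeasure_graph_lt_top {N : ℕ} {e : E N} (he : ‖e‖ = 1) {γ : (ℝ ∙ e)ᗮ → ℝ}
    (hγ : ContDiff ℝ 1 γ) (R : ℝ) :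
    Measure.euclideanHausdorffMeasure (N - 1)
      ((fun w : (ℝ ∙ e)ᗮ => (w : E N) + γ w • e) '' Metric.closedBall 0 R) < ⊤ := by
  have hfin : Module.finrank ℝ (ℝ ∙ e)ᗮ = N - 1 := by
    have h1 := Submodule.finrank_add_finrank_orthogonal (ℝ ∙ e)
    have h2 : Module.finrank ℝ (ℝ ∙ e) = 1 := finrank_span_singleton (by
      rintro rfl; simp at he)
    rw [h2, finrank_euclideanSpace_fin] at h1
    omega
  -- The graph map is `C¹`, hence Lipschitz on the compact ball, and a Lipschitz map enlarges
  -- `(N-1)`-dimensional Hausdorff measure by at most a finite factor.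
  have hG : ContDiff ℝ 1 fun w : (ℝ ∙ e)ᗮ => (w : E N) + γ w • e :=
    ((ℝ ∙ e)ᗮ.subtypeL.contDiff).add (hγ.smul contDiff_const)
  have hloc := (hG.locallyLipschitz).locallyLipschitzOn (s := Metric.closedBall 0 R)
  obtain ⟨K, hK⟩ := hloc.exists_lipschitzOnWith_of_compact (isCompact_closedBall 0 R)
  rw [hausdorffMeasure_lt_top_iff_euclidean]
  refine (hK.hausdorffMeasure_image_le (Nat.cast_nonneg _)).trans_lt ?_
  refine ENNReal.mul_lt_top (ENNReal.rpow_lt_top_of_nonneg (Nat.cast_nonneg _) ENNReal.coe_ne_top) ?_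
  rw [← hausdorffMeasure_lt_top_iff_euclidean, ← hfin]
  exact (isCompact_closedBall 0 R).measure_lt_top

/-- The boundary is compact, so it suffices that each boundary point has a relative neighbourhood of
finite measure; such a neighbourhood lies on a graph over a ball of the hyperplane. -/
lemma isFiniteMeasure_surface {N : ℕ} {Ω : Set (E N)} (ho : IsOpen Ω)
    (hb : Bornology.IsBounded Ω) (hC : HasC11Boundary Ω) : IsFiniteMeasure (surface Ω) := by
  have hcpt : IsCompact (frontier Ω) :=
    hb.isCompact_closure.of_isClosed_subset isClosed_frontier frontier_subset_closure
  refine ⟨?_⟩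
  rw [surface, Measure.restrict_apply_univ]
  refine hcpt.measure_lt_top_of_nhdsWithin fun x₀ hx₀ => ?_
  obtain ⟨ε, e, γ, L, hε, he, hγ, -, h⟩ := hC x₀ hx₀
  refine ⟨frontier Ω ∩ Metric.ball x₀ ε,
    inter_mem_nhdsWithin _ (Metric.ball_mem_nhds x₀ hε), ?_⟩
  refine lt_of_le_of_lt (measure_mono ?_) (hausdorffMeasure_graph_lt_top he hγ (‖x₀‖ + ε))
  rintro x ⟨hxf, hxb⟩
  set P := (ℝ ∙ e)ᗮ.orthogonalProjectionOnto with hP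
  have hcont : Continuous fun x : E N => γ (P x) := hγ.continuous.comp P.continuous
  have hcont' : Continuous fun x : E N => (inner ℝ e x : ℝ) := by fun_prop
  -- A boundary point lies on the graph: strictly below it, a whole neighbourhood would miss `Ω`;
  -- strictly above it, the point would belong to the open set `Ω`.
  have heq : γ (P x) = inner ℝ e x := by
    refine le_antisymm ?_ ?_
    · by_contra! hlt
      have hev : ∀ᶠ x' in 𝓝 x, x' ∉ Ω := by
        filter_upwards [Metric.isOpen_ball.mem_nhds hxb,
          (isOpen_lt hcont' hcont).mem_nhds hlt] with x' h1 h2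
        rw [h x' h1]
        exact not_lt.2 (le_of_lt h2)
      have hcl : x ∈ closure Ω := frontier_subset_closure hxf
      rw [mem_closure_iff_frequently] at hcl
      exact hcl hev
    · by_contra! hlt
      have hxΩ : x ∈ Ω := (h x hxb).2 hlt
      rw [frontier, ho.interior_eq] at hxf
      exact hxf.2 hxΩ
  refine ⟨P x, ?_, ?_⟩
  · rw [mem_closedBall_zero_iff]
    have h1 : ‖P x‖ ≤ ‖x‖ := Submodule.norm_orthogonalProjectionOnto_apply_le _ _
    have h2 : ‖x‖ ≤ ‖x₀‖ + ε := by
      have := norm_le_norm_add_norm_sub' x x₀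
      have h3 : ‖x - x₀‖ < ε := by simpa [dist_eq_norm] using hxb
      linarith
    exact h1.trans h2
  · have h1 := (ℝ ∙ e).starProjection_add_starProjection_orthogonal x
    have h2 := Submodule.starProjection_unit_singleton ℝ he x
    simp only [heq]
    rw [h2] at h1
    conv_rhs => rw [← h1, add_comm]
    rfl

/-! ### Weak derivatives in one variable -/

/-- The smoothed step rises only to the right of `c`, so the limit at `c` itself is `0` and
convergence holds at every point. -/
lemma tendsto_smoothTransition_div (c x : ℝ) :
    Tendsto (fun ε : ℝ => Real.smoothTransition ((x - c) / ε)) (𝓝[>] 0)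
      (𝓝 ((Ioi c).indicator (fun _ => (1 : ℝ)) x)) := by
  by_cases hx : c < x
  · rw [indicator_of_mem (mem_Ioi.2 hx)]
    refine tendsto_const_nhds.congr' ?_
    filter_upwards [Ioc_mem_nhdsGT (sub_pos.2 hx)] with ε hε
    exact (Real.smoothTransition.one_of_one_le ((one_le_div hε.1).2 hε.2)).symm
  · rw [indicator_of_notMem (by simpa using hx)]
    refine tendsto_const_nhds.congr' ?_
    filter_upwards [self_mem_nhdsWithin] with ε hε
    exact (Real.smoothTransition.zero_of_nonpos
      (div_nonpos_of_nonpos_of_nonneg (by linarith [not_lt.1 hx]) (le_of_lt hε))).symm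

lemma contDiff_smoothTransition_div (c ε : ℝ) :
    ContDiff ℝ ∞ fun x : ℝ => Real.smoothTransition ((x - c) / ε) :=
  Real.smoothTransition.contDiff.comp ((contDiff_id.sub contDiff_const).div_const ε)

lemma smoothTransition_div_eventuallyEq {c ε x : ℝ} (hε : 0 < ε) (hx : x ∉ Icc c (c + ε)) :
    ∃ a : ℝ, (fun x : ℝ => Real.smoothTransition ((x - c) / ε)) =ᶠ[𝓝 x] fun _ => a := by
  by_cases h : x < c
  · refine ⟨0, ?_⟩
    filter_upwards [Iio_mem_nhds h] with z hz
    exact Real.smoothTransition.zero_of_nonpos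
      (div_nonpos_of_nonpos_of_nonneg (by linarith [mem_Iio.1 hz]) hε.le)
  · have h' : c + ε < x := by
      by_contra h''
      exact hx ⟨not_lt.1 h, not_lt.1 h''⟩
    refine ⟨1, ?_⟩
    filter_upwards [Ioi_mem_nhds h'] with z hz
    exact Real.smoothTransition.one_of_one_le
      ((one_le_div hε).2 (by linarith [mem_Ioi.1 hz]))

/-- The derivatives of the smoothed unit steps at `c` converge to the Dirac measure at `c`. -/
lemma tendsto_integral_deriv_smoothTransition_mul {T : ℝ} {f : ℝ → ℝ} (hf : Continuous f) {c : ℝ}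
    (hc : c ∈ Ioo 0 T) :
    Tendsto (fun ε : ℝ => ∫ x in Ioo 0 T,
      deriv (fun x : ℝ => Real.smoothTransition ((x - c) / ε)) x * f x) (𝓝[>] 0) (𝓝 (f c)) := by
  rw [Metric.tendsto_nhds]
  intro η hη
  obtain ⟨δ, hδ, hfδ⟩ := Metric.continuousAt_iff.1 (hf.continuousAt (x := c)) (η / 2) (half_pos hη)
  have hTc : 0 < T - c := sub_pos.2 hc.2
  filter_upwards [Ioo_mem_nhdsGT (lt_min hδ hTc)] with ε hε
  have hε0 : 0 < ε := hε.1
  have hεδ : ε < δ := hε.2.trans_le (min_le_left _ _)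
  have hεT : ε < T - c := hε.2.trans_le (min_le_right _ _)
  set S : ℝ → ℝ := fun x => Real.smoothTransition ((x - c) / ε) with hS
  have hSd : ContDiff ℝ ∞ S := contDiff_smoothTransition_div c ε
  have hSc : Continuous (deriv S) := hSd.continuous_deriv (by simp)
  have hmono : Monotone S := fun a b hab =>
    Real.smoothTransition.monotone (div_le_div_of_nonneg_right (by linarith) hε0.le)
  have e1 : ∫ x in Ioo 0 T, deriv S x * f x = ∫ x in c..c + ε, deriv S x * f x := by
    rw [intervalIntegral.integral_of_le (by linarith), ← integral_Icc_eq_integral_Ioc]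
    refine setIntegral_eq_of_subset_of_forall_sdiff_eq_zero measurableSet_Ioo
      (fun x hx => ⟨hc.1.trans_le hx.1, hx.2.trans_lt (by linarith)⟩) ?_
    rintro x ⟨-, hx⟩
    obtain ⟨a, ha⟩ := smoothTransition_div_eventuallyEq hε0 hx
    have : deriv S x = 0 := by rw [ha.deriv_eq]; simp
    rw [this, zero_mul]
  have e2 : ∫ x in c..c + ε, deriv S x = 1 := by
    rw [intervalIntegral.integral_deriv_eq_sub
      (fun x _ => (hSd.differentiable (by simp)).differentiableAt)
      (hSc.intervalIntegrable _ _)]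
    simp [hS, div_self hε0.ne']
  -- Since `deriv S` is nonnegative with integral `1`, the error is a weighted mean of `f x - f c`
  -- over an interval shorter than `δ`.
  have e3 : (∫ x in c..c + ε, deriv S x * f x) - f c
      = ∫ x in c..c + ε, deriv S x * (f x - f c) := by
    have hSf : Continuous fun x => deriv S x * f x := hSc.mul hf
    have hSf' : Continuous fun x => deriv S x * f c := hSc.mul continuous_const
    have : ∫ x in c..c + ε, deriv S x * (f x - f c)
        = (∫ x in c..c + ε, deriv S x * f x) - ∫ x in c..c + ε, deriv S x * f c := by
      rw [← intervalIntegral.integral_sub (hSf.intervalIntegrable _ _)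
        (hSf'.intervalIntegrable _ _)]
      simp_rw [mul_sub]
    rw [this, intervalIntegral.integral_mul_const, e2, one_mul]
  rw [e1, Real.dist_eq, e3]
  refine lt_of_le_of_lt (b := η / 2) ?_ (half_lt_self hη)
  have h4 : ∫ x in c..c + ε, deriv S x * (η / 2) = η / 2 := by
    rw [intervalIntegral.integral_mul_const, e2, one_mul]
  rw [← Real.norm_eq_abs]
  refine (intervalIntegral.norm_integral_le_of_norm_le (g := fun x => deriv S x * (η / 2))
    (by linarith) (ae_of_all _ fun x hx => ?_)
    ((hSc.mul continuous_const).intervalIntegrable _ _)).trans h4.le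
  rw [norm_mul, Real.norm_of_nonneg hmono.deriv_nonneg]
  refine mul_le_mul_of_nonneg_left ?_ hmono.deriv_nonneg
  have := hfδ (x := x) (by rw [Real.dist_eq, abs_lt]; constructor <;> linarith [hx.1, hx.2])
  rw [Real.dist_eq] at this
  exact this.le

/-- A continuous function with an integrable weak derivative is a primitive of it. -/
lemma sub_eq_integral_of_weak_deriv {T : ℝ} {f g : ℝ → ℝ} (hf : Continuous f)
    (hg : IntegrableOn g (Ioo 0 T))
    (h : ∀ φ : ℝ → ℝ, ContDiff ℝ ∞ φ → HasCompactSupport φ → tsupport φ ⊆ Ioo 0 T →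
      ∫ t in Ioo 0 T, deriv φ t * f t = - ∫ t in Ioo 0 T, φ t * g t)
    {s t : ℝ} (hs : 0 < s) (hst : s ≤ t) (ht : t < T) :
    f t - f s = ∫ τ in s..t, g τ := by
  -- The test function is `S s ε - S t ε`, a smoothed indicator of `(s, t]`. Its support lies in
  -- `[s, t + ε]`, hence in `(0, T)` for small `ε`; as `ε → 0` the two sides of the weak identity
  -- tend to `f s - f t` and `-∫ g` over `(s, t]`.
  set S : ℝ → ℝ → ℝ → ℝ := fun c ε x => Real.smoothTransition ((x - c) / ε) with hS
  have hSd : ∀ c ε, ContDiff ℝ ∞ (S c ε) := contDiff_smoothTransition_div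
  have hsT : s ∈ Ioo 0 T := ⟨hs, hst.trans_lt ht⟩
  have htT : t ∈ Ioo 0 T := ⟨hs.trans_le hst, ht⟩
  have hint : ∀ c ε, IntegrableOn (fun x => deriv (S c ε) x * f x) (Ioo 0 T) := fun c ε =>
    ((((hSd c ε).continuous_deriv (by simp)).mul hf).integrableOn_Icc (a := 0) (b := T)).mono_set
      Ioo_subset_Icc_self
  have L1 : Tendsto (fun ε => ∫ x in Ioo 0 T, deriv (fun x => S s ε x - S t ε x) x * f x)
      (𝓝[>] 0) (𝓝 (f s - f t)) := by
    refine ((tendsto_integral_deriv_smoothTransition_mul hf hsT).sub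
      (tendsto_integral_deriv_smoothTransition_mul hf htT)).congr fun ε => ?_
    rw [← integral_sub (hint s ε) (hint t ε)]
    refine integral_congr_ae (ae_of_all _ fun x => ?_)
    have : deriv (fun x => S s ε x - S t ε x) x = deriv (S s ε) x - deriv (S t ε) x :=
      deriv_fun_sub ((hSd s ε).differentiable (by simp)).differentiableAt
        ((hSd t ε).differentiable (by simp)).differentiableAt
    simp only [this, sub_mul]
  have L2 : Tendsto (fun ε => ∫ x in Ioo 0 T, (S s ε x - S t ε x) * g x) (𝓝[>] 0)
      (𝓝 (∫ x in Ioo 0 T, ((Ioi s).indicator (fun _ => (1 : ℝ)) x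
        - (Ioi t).indicator (fun _ => (1 : ℝ)) x) * g x)) := by
    refine tendsto_integral_filter_of_dominated_convergence (fun x => ‖g x‖) ?_ ?_ hg.norm ?_
    · exact Eventually.of_forall fun ε => ((((hSd s ε).continuous.sub
        (hSd t ε).continuous)).aestronglyMeasurable).mul hg.aestronglyMeasurable
    · refine Eventually.of_forall fun ε => ae_of_all _ fun x => ?_
      rw [norm_mul]
      refine mul_le_of_le_one_left (norm_nonneg _) ?_
      rw [Real.norm_eq_abs, abs_le]
      have h1 := Real.smoothTransition.nonneg ((x - s) / ε)
      have h2 := Real.smoothTransition.le_one ((x - s) / ε)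
      have h3 := Real.smoothTransition.nonneg ((x - t) / ε)
      have h4 := Real.smoothTransition.le_one ((x - t) / ε)
      constructor <;> simp only [hS] <;> linarith
    · exact ae_of_all _ fun x => ((tendsto_smoothTransition_div s x).sub
        (tendsto_smoothTransition_div t x)).mul_const _
  have hev : ∀ᶠ ε in 𝓝[>] (0 : ℝ),
      ∫ x in Ioo 0 T, deriv (fun x => S s ε x - S t ε x) x * f x
        = - ∫ x in Ioo 0 T, (S s ε x - S t ε x) * g x := by
    filter_upwards [Ioo_mem_nhdsGT (sub_pos.2 ht)] with ε hε
    have hε0 : 0 < ε := hε.1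
    have hsub : Function.support (fun x => S s ε x - S t ε x) ⊆ Icc s (t + ε) := by
      intro x hx
      by_contra hx'
      refine hx ?_
      by_cases h1 : x < s
      · have a1 : S s ε x = 0 := Real.smoothTransition.zero_of_nonpos
          (div_nonpos_of_nonpos_of_nonneg (by linarith) hε0.le)
        have a2 : S t ε x = 0 := Real.smoothTransition.zero_of_nonpos
          (div_nonpos_of_nonpos_of_nonneg (by linarith) hε0.le)
        simp only [a1, a2, sub_zero]
      · have h2 : t + ε < x := by
          by_contra h''
          exact hx' ⟨not_lt.1 h1, not_lt.1 h''⟩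
        have a1 : S s ε x = 1 := Real.smoothTransition.one_of_one_le
          ((one_le_div hε0).2 (by linarith))
        have a2 : S t ε x = 1 := Real.smoothTransition.one_of_one_le
          ((one_le_div hε0).2 (by linarith))
        simp only [a1, a2, sub_self]
    have hts : tsupport (fun x => S s ε x - S t ε x) ⊆ Icc s (t + ε) :=
      closure_minimal hsub isClosed_Icc
    exact h _ ((hSd s ε).sub (hSd t ε)) (isCompact_Icc.of_isClosed_subset (isClosed_tsupport _) hts)
      (hts.trans fun x hx => ⟨hs.trans_le hx.1, hx.2.trans_lt (by linarith [hε.2])⟩)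
  have hlim := tendsto_nhds_unique (L1.congr' hev) L2.neg
  have hI : ∫ x in Ioo 0 T, ((Ioi s).indicator (fun _ => (1 : ℝ)) x
        - (Ioi t).indicator (fun _ => (1 : ℝ)) x) * g x = ∫ τ in s..t, g τ := by
    rw [intervalIntegral.integral_of_le hst]
    have : ∀ x, ((Ioi s).indicator (fun _ => (1 : ℝ)) x
        - (Ioi t).indicator (fun _ => (1 : ℝ)) x) * g x = (Ioc s t).indicator g x := by
      intro x
      by_cases h1 : s < x <;> by_cases h2 : t < x
      · simp [indicator, h1, h2]
      · simp [indicator, h1, h2, not_lt.1 h2]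
      · exact absurd (hst.trans_lt h2) h1
      · simp [indicator, h1, h2]
    simp_rw [this]
    rw [setIntegral_indicator measurableSet_Ioc, inter_eq_self_of_subset_right]
    exact fun x hx => ⟨hs.trans hx.1, hx.2.trans_lt ht⟩
  rw [hI] at hlim
  linarith

/-! ### Translation in `L²(ℝ)` and integration by parts -/

section

variable {V H : Type*} [NormedAddCommGroup V] [NormedSpace ℝ V] [NormedAddCommGroup H]
  [InnerProductSpace ℝ H]

/-- Translation acts continuously on `L²(ℝ)`, and the duality pairing is a bounded bilinear map from
`L² × L²` to `L¹`. This is why functions of time are extended to the whole line below. -/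
lemma continuous_integral_translate_pairing {g : ℝ → StrongDual ℝ V} {p : ℝ → V}
    (hg : MemLp g 2) (hp : MemLp p 2) (s : Set ℝ) :
    Continuous fun z : ℝ × ℝ => ∫ t in s, g (t + z.1) (p (t + z.2)) := by
  have hmp : ∀ a : ℝ, MeasurePreserving (ContinuousMap.addRight a : C(ℝ, ℝ)) volume volume :=
    fun a => measurePreserving_add_right volume a
  have hcurry : Continuous fun a : ℝ => (ContinuousMap.addRight a : C(ℝ, ℝ)) :=
    ContinuousMap.continuous_of_continuous_uncurry _ (by
      simp only [Function.uncurry_def, ContinuousMap.coe_addRight]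
      fun_prop)
  have h1 : Continuous fun z : ℝ × ℝ =>
      Lp.compMeasurePreserving (ContinuousMap.addRight z.1 : C(ℝ, ℝ)) (hmp z.1) (hg.toLp g) :=
    continuous_const.compMeasurePreservingLp (hcurry.comp continuous_fst) (fun z => hmp z.1)
      (by simp)
  have h2 : Continuous fun z : ℝ × ℝ =>
      Lp.compMeasurePreserving (ContinuousMap.addRight z.2 : C(ℝ, ℝ)) (hmp z.2) (hp.toLp p) :=
    continuous_const.compMeasurePreservingLp (hcurry.comp continuous_snd) (fun z => hmp z.2)
      (by simp)
  have h3 := (((ContinuousLinearMap.id ℝ (StrongDual ℝ V)).holderL volume 2 2 1).continuous₂.comp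
    (h1.prodMk h2))
  refine ((continuous_setIntegral s).comp h3).congr fun z => ?_
  refine integral_congr_ae (ae_restrict_of_ae ?_)
  filter_upwards [ContinuousLinearMap.coeFn_holder (r := 1)
      (ContinuousLinearMap.id ℝ (StrongDual ℝ V))
      (Lp.compMeasurePreserving (ContinuousMap.addRight z.1 : C(ℝ, ℝ)) (hmp z.1) (hg.toLp g))
      (Lp.compMeasurePreserving (ContinuousMap.addRight z.2 : C(ℝ, ℝ)) (hmp z.2) (hp.toLp p)),
    Lp.coeFn_compMeasurePreserving (hg.toLp g) (hmp z.1),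
    Lp.coeFn_compMeasurePreserving (hp.toLp p) (hmp z.2),
    (hmp z.1).quasiMeasurePreserving.ae_eq_comp hg.coeFn_toLp,
    (hmp z.2).quasiMeasurePreserving.ae_eq_comp hp.coeFn_toLp] with t e1 e2 e3 e4 e5
  refine e1.trans ?_
  rw [e2, e3, e4, e5]
  rfl

/-- The averaging window and the parameter of the integrand shrink together, so joint continuity at
the origin is what is needed. -/
lemma tendsto_average {G : ℝ × ℝ → ℝ} (hG : Continuous G) :
    Tendsto (fun h : ℝ => h⁻¹ * ∫ σ in (0 : ℝ)..h, G (σ, h)) (𝓝[>] 0) (𝓝 (G (0, 0))) := by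
  rw [Metric.tendsto_nhds]
  intro η hη
  obtain ⟨δ, hδ, hGδ⟩ := Metric.continuousAt_iff.1 (hG.continuousAt (x := (0, 0))) (η / 2)
    (half_pos hη)
  filter_upwards [Ioo_mem_nhdsGT hδ] with h hh
  have hh0 : 0 < h := hh.1
  have hGi : IntervalIntegrable (fun σ => G (σ, h)) volume 0 h :=
    (hG.comp (by fun_prop : Continuous fun σ : ℝ => (σ, h))).intervalIntegrable _ _
  have e : (h⁻¹ * ∫ σ in (0 : ℝ)..h, G (σ, h)) - G (0, 0)
      = h⁻¹ * ∫ σ in (0 : ℝ)..h, (G (σ, h) - G (0, 0)) := by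
    rw [intervalIntegral.integral_sub hGi intervalIntegrable_const,
      intervalIntegral.integral_const, smul_eq_mul, sub_zero, mul_sub, ← mul_assoc,
      inv_mul_cancel₀ hh0.ne', one_mul]
  have hb : ‖∫ σ in (0 : ℝ)..h, (G (σ, h) - G (0, 0))‖ ≤ η / 2 * |h - 0| := by
    refine intervalIntegral.norm_integral_le_of_norm_le_const fun σ hσ => ?_
    rw [uIoc_of_le hh0.le] at hσ
    have := hGδ (x := (σ, h)) (by
      rw [Prod.dist_eq, max_lt_iff, Real.dist_eq, Real.dist_eq, sub_zero, sub_zero,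
        abs_of_pos hσ.1, abs_of_pos hh0]
      exact ⟨hσ.2.trans_lt hh.2, hh.2⟩)
    rw [Real.dist_eq] at this
    exact this.le
  rw [Real.dist_eq, e, abs_mul, abs_of_pos (inv_pos.2 hh0), ← Real.norm_eq_abs (∫ _ in _.._, _)]
  rw [sub_zero, abs_of_pos hh0] at hb
  calc h⁻¹ * _ ≤ h⁻¹ * (η / 2 * h) := mul_le_mul_of_nonneg_left hb (inv_pos.2 hh0).le
    _ = η / 2 := by field_simp
    _ < η := half_lt_self hη

/-- Fubini applies because the shear `(t, σ) ↦ (t + σ, σ)` preserves measure on `ℝ × (0, h]`: both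
factors are then square integrable there. -/
lemma integral_integral_translate_pairing_swap {g : ℝ → StrongDual ℝ V} {p : ℝ → V}
    (hg : MemLp g 2) (hp : MemLp p 2) {a b h : ℝ} (hab : a ≤ b) (hh : 0 ≤ h) :
    IntervalIntegrable (fun t => ∫ σ in (0 : ℝ)..h, g (t + σ) (p t)) volume a b ∧
    ∫ t in a..b, ∫ σ in (0 : ℝ)..h, g (t + σ) (p t)
      = ∫ σ in (0 : ℝ)..h, ∫ t in a..b, g (t + σ) (p t) := by
  set ν : Measure ℝ := volume.restrict (Ioc 0 h) with hν
  have h1 : MemLp (fun z : ℝ × ℝ => g (z.1 + z.2)) 2 ((volume : Measure ℝ).prod ν) :=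
    (hg.comp_fst ν).comp_measurePreserving (measurePreserving_add_prod volume ν)
  have h2 : MemLp (fun z : ℝ × ℝ => p z.1) 2 ((volume : Measure ℝ).prod ν) := hp.comp_fst ν
  have h3 : Integrable (fun z : ℝ × ℝ => g (z.1 + z.2) (p z.1)) ((volume : Measure ℝ).prod ν) :=
    memLp_one_iff_integrable.1
      ((ContinuousLinearMap.id ℝ (StrongDual ℝ V)).memLp_of_bilin 1 h1 h2)
  have h4 : Integrable (Function.uncurry fun t σ : ℝ => g (t + σ) (p t))
      ((volume.restrict (Ioc a b)).prod ν) :=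
    h3.mono_measure (Measure.prod_mono Measure.restrict_le_self le_rfl)
  refine ⟨?_, ?_⟩
  · rw [intervalIntegrable_iff_integrableOn_Ioc_of_le hab]
    simp_rw [intervalIntegral.integral_of_le hh]
    exact h4.integral_prod_left
  · simp_rw [intervalIntegral.integral_of_le hh, intervalIntegral.integral_of_le hab]
    exact integral_integral_swap h4

lemma integrable_dual_pairing {α : Type*} [MeasurableSpace α] {m : Measure α}
    {g : α → StrongDual ℝ V} {p : α → V} (hg : MemLp g 2 m) (hp : MemLp p 2 m) :
    Integrable (fun t => g t (p t)) m :=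
  memLp_one_iff_integrable.1 ((ContinuousLinearMap.id ℝ (StrongDual ℝ V)).memLp_of_bilin 1 hg hp)

/-- Shifting leaves only the end pieces: both sides equal the integral of `F` over `[s, s + h]`
minus that over `[r, r + h]`. -/
lemma integral_shift_sub {F : ℝ → ℝ} (hF : Continuous F) (r s h : ℝ) :
    ∫ t in r..s, (F (t + h) - F t) = ∫ σ in (0 : ℝ)..h, (F (s + σ) - F (r + σ)) := by
  have hi : ∀ a b, IntervalIntegrable F volume a b := fun a b => hF.intervalIntegrable a b
  have c1 : Continuous fun t => F (t + h) := by fun_prop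
  have c2 : Continuous fun σ => F (s + σ) := by fun_prop
  have c3 : Continuous fun σ => F (r + σ) := by fun_prop
  rw [intervalIntegral.integral_sub (c1.intervalIntegrable _ _) (hi _ _),
    intervalIntegral.integral_sub (c2.intervalIntegrable _ _) (c3.intervalIntegrable _ _),
    intervalIntegral.integral_comp_add_right, intervalIntegral.integral_comp_add_left,
    intervalIntegral.integral_comp_add_left, add_zero, add_zero]
  have e1 := intervalIntegral.integral_add_adjacent_intervals (hi r (r + h)) (hi (r + h) (s + h))
  have e2 := intervalIntegral.integral_add_adjacent_intervals (hi r s) (hi s (s + h))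
  linarith

/-- Integration by parts in `W(0,T)`, away from the end points of the time interval. -/
lemma inner_sub_inner_eq_integral {ι : V → H} {T : ℝ} {b c : ℝ → H} (hb : Continuous b)
    (hc : Continuous c) {y p : ℝ → V} {y' p' : ℝ → StrongDual ℝ V} (hy : MemLp y 2)
    (hp : MemLp p 2) (hy' : MemLp y' 2) (hp' : MemLp p' 2)
    (hby : ∀ᵐ t ∂volume.restrict (Ioo 0 T), b t = ι (y t))
    (hcp : ∀ᵐ t ∂volume.restrict (Ioo 0 T), c t = ι (p t))
    (hb' : ∀ (η : V) (s t : ℝ), 0 < s → s ≤ t → t < T →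
      inner ℝ (b t - b s) (ι η) = ∫ τ in s..t, y' τ η)
    (hc' : ∀ (η : V) (s t : ℝ), 0 < s → s ≤ t → t < T →
      inner ℝ (c t - c s) (ι η) = ∫ τ in s..t, p' τ η)
    {r s : ℝ} (hr : 0 < r) (hrs : r ≤ s) (hs : s < T) :
    inner ℝ (b s) (c s) - inner ℝ (b r) (c r) = ∫ t in r..s, (y' t (p t) + p' t (y t)) := by
  set F : ℝ → ℝ := fun t => inner ℝ (b t) (c t) with hF
  have hFc : Continuous F := hb.inner hc
  -- The quotient `h⁻¹ ∫ (F(t + h) - F(t))` over `[r, s]` is computed in two ways. By end pieces it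
  -- tends to `F s - F r`; by the weak derivatives it tends to the integral of the two pairings.
  have L1 := tendsto_average (G := fun z => F (s + z.1) - F (r + z.1)) (by fun_prop)
  have hG2 : Continuous fun z : ℝ × ℝ => (∫ t in Ioc r s, y' (t + z.1) (p (t + z.2)))
      + ∫ t in Ioc r s, p' (t + z.1) (y (t + 0)) := by
    refine (continuous_integral_translate_pairing hy' hp (Ioc r s)).add ?_
    exact (continuous_integral_translate_pairing hp' hy (Ioc r s)).comp
      (by fun_prop : Continuous fun z : ℝ × ℝ => (z.1, (0 : ℝ)))
  have L2 := tendsto_average hG2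
  have hev : ∀ᶠ h in 𝓝[>] (0 : ℝ), h⁻¹ * ∫ σ in (0 : ℝ)..h, (F (s + σ) - F (r + σ))
      = h⁻¹ * ∫ σ in (0 : ℝ)..h, ((∫ t in Ioc r s, y' (t + σ) (p (t + h)))
      + ∫ t in Ioc r s, p' (t + σ) (y (t + 0))) := by
    filter_upwards [Ioo_mem_nhdsGT (sub_pos.2 hs)] with h hh
    have hh0 : 0 < h := hh.1
    have hhT : h < T - s := hh.2
    have hph : MemLp (fun t => p (t + h)) 2 :=
      hp.comp_measurePreserving (measurePreserving_add_right volume h)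
    obtain ⟨i1, s1⟩ := integral_integral_translate_pairing_swap hy' hph hrs hh0.le
    obtain ⟨i2, s2⟩ := integral_integral_translate_pairing_swap hp' hy hrs hh0.le
    rw [← integral_shift_sub hFc]
    congr 1
    have hcp' : ∀ᵐ t : ℝ, t + h ∈ Ioo 0 T → c (t + h) = ι (p (t + h)) :=
      (measurePreserving_add_right volume h).quasiMeasurePreserving.ae
        ((ae_restrict_iff' measurableSet_Ioo).1 hcp)
    have hby' := (ae_restrict_iff' measurableSet_Ioo).1 hby
    -- Discrete product rule: `F(t+h) - F(t) = ⟨b(t+h) - b(t), c(t+h)⟩ + ⟨b(t), c(t+h) - c(t)⟩`. For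
    -- almost every `t` the undifferenced factors are `ι (p (t+h))` and `ι (y t)`, fixed elements
    -- admissible in `hb'` and `hc'`.
    have e1 : ∫ t in r..s, (F (t + h) - F t)
        = ∫ t in r..s, ((∫ σ in (0 : ℝ)..h, y' (t + σ) (p (t + h)))
          + ∫ σ in (0 : ℝ)..h, p' (t + σ) (y t)) := by
      refine intervalIntegral.integral_congr_ae ?_
      filter_upwards [hcp', hby'] with t h1 h2 ht
      rw [uIoc_of_le hrs] at ht
      have ht0 : 0 < t := hr.trans ht.1
      have k1 := hb' (p (t + h)) t (t + h) ht0 (by linarith) (by linarith [ht.2])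
      have k2 := hc' (y t) t (t + h) ht0 (by linarith) (by linarith [ht.2])
      rw [intervalIntegral.integral_comp_add_left (fun τ => y' τ (p (t + h))) t,
        intervalIntegral.integral_comp_add_left (fun τ => p' τ (y t)) t, add_zero, ← k1, ← k2,
        ← h1 ⟨by linarith, by linarith [ht.2]⟩, ← h2 ⟨ht0, by linarith [ht.2]⟩, hF,
        real_inner_comm (b t) (c (t + h) - c t), inner_sub_left, inner_sub_right]
      ring
    rw [e1, intervalIntegral.integral_add i1 i2, s1, s2, ← intervalIntegral.integral_add]
    · simp_rw [intervalIntegral.integral_of_le hrs, add_zero]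
    · simp_rw [intervalIntegral.integral_of_le hrs]
      exact Continuous.intervalIntegrable ((continuous_integral_translate_pairing hy' hp
        (Ioc r s)).comp (by fun_prop : Continuous fun σ : ℝ => (σ, h))) _ _
    · simp_rw [intervalIntegral.integral_of_le hrs]
      have := Continuous.intervalIntegrable (μ := volume)
        ((continuous_integral_translate_pairing hp' hy
          (Ioc r s)).comp (by fun_prop : Continuous fun σ : ℝ => (σ, (0 : ℝ)))) 0 h
      simpa [Function.comp_def] using this
  have hlim := tendsto_nhds_unique (L1.congr' hev) L2
  simp only [add_zero] at hlim
  rw [hlim, intervalIntegral.integral_of_le hrs, integral_add]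
  · exact (integrable_dual_pairing hy' hp).integrableOn
  · exact (integrable_dual_pairing hp' hy).integrableOn

/-- Integration by parts in `W(0,T)`, for functions with continuous representatives in the pivot
space. -/
theorem inner_sub_inner_eq_integral_add {ι : V → H} {T : ℝ} (hT : 0 < T) {b c : ℝ → H}
    (hb : ContinuousOn b (Icc 0 T)) (hc : ContinuousOn c (Icc 0 T))
    {y p : ℝ → V} {y' p' : ℝ → StrongDual ℝ V}
    (hy : MemLp y 2 (volume.restrict (Ioo 0 T))) (hp : MemLp p 2 (volume.restrict (Ioo 0 T)))
    (hy' : MemLp y' 2 (volume.restrict (Ioo 0 T))) (hp' : MemLp p' 2 (volume.restrict (Ioo 0 T)))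
    (hby : ∀ᵐ t ∂volume.restrict (Ioo 0 T), b t = ι (y t))
    (hcp : ∀ᵐ t ∂volume.restrict (Ioo 0 T), c t = ι (p t))
    (hwy : ∀ φ : ℝ → ℝ, ContDiff ℝ ∞ φ → HasCompactSupport φ → tsupport φ ⊆ Ioo 0 T → ∀ η : V,
      ∫ t in Ioo 0 T, deriv φ t * inner ℝ (ι (y t)) (ι η) = - ∫ t in Ioo 0 T, φ t * y' t η)
    (hwp : ∀ φ : ℝ → ℝ, ContDiff ℝ ∞ φ → HasCompactSupport φ → tsupport φ ⊆ Ioo 0 T → ∀ η : V,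
      ∫ t in Ioo 0 T, deriv φ t * inner ℝ (ι (p t)) (ι η) = - ∫ t in Ioo 0 T, φ t * p' t η) :
    inner ℝ (b T) (c T) - inner ℝ (b 0) (c 0)
      = (∫ t in Ioo 0 T, y' t (p t)) + ∫ t in Ioo 0 T, p' t (y t) := by
  -- Extend `b` by its end values and `y`, `y'` by zero to the whole line. The jumps of the zero
  -- extension do no harm, since the increment formula is claimed only for `0 < s ≤ t < T`.
  have key : ∀ {b : ℝ → H} {y : ℝ → V} {y' : ℝ → StrongDual ℝ V}, ContinuousOn b (Icc 0 T) →
      MemLp y' 2 (volume.restrict (Ioo 0 T)) →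
      (∀ᵐ t ∂volume.restrict (Ioo 0 T), b t = ι (y t)) →
      (∀ φ : ℝ → ℝ, ContDiff ℝ ∞ φ → HasCompactSupport φ → tsupport φ ⊆ Ioo 0 T → ∀ η : V,
      ∫ t in Ioo 0 T, deriv φ t * inner ℝ (ι (y t)) (ι η) = - ∫ t in Ioo 0 T, φ t * y' t η) →
      ∃ B : ℝ → H, Continuous B ∧ EqOn B b (Icc 0 T) ∧
        (∀ᵐ t ∂volume.restrict (Ioo 0 T), B t = ι ((Ioo 0 T).indicator y t)) ∧
        ∀ (η : V) (s t : ℝ), 0 < s → s ≤ t → t < T →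
          inner ℝ (B t - B s) (ι η) = ∫ τ in s..t, (Ioo 0 T).indicator y' τ η := by
    intro b y y' hb hy' hby hwy
    have hBe : EqOn (IccExtend hT.le ((Icc 0 T).domRestrict b)) b (Icc 0 T) := fun t ht => by
      rw [IccExtend_of_mem _ _ ht]; rfl
    have hBc : Continuous (IccExtend hT.le ((Icc 0 T).domRestrict b)) :=
      (continuousOn_iff_continuous_domRestrict.1 hb).Icc_extend'
    refine ⟨_, hBc, hBe, ?_, ?_⟩
    · filter_upwards [hby, ae_restrict_mem measurableSet_Ioo] with t h1 h2
      rw [hBe (Ioo_subset_Icc_self h2), indicator_of_mem h2, h1]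
    · intro η s t hs hst ht
      rw [inner_sub_left]
      have hint : IntegrableOn (fun t => y' t η) (Ioo 0 T) :=
        (((ContinuousLinearMap.apply ℝ ℝ η).comp_memLp' hy').integrable one_le_two)
      rw [sub_eq_integral_of_weak_deriv (T := T) (g := fun t => y' t η)
        (hBc.inner continuous_const) hint ?_ hs hst ht]
      · refine intervalIntegral.integral_congr fun τ hτ => ?_
        rw [uIcc_of_le hst] at hτ
        have : τ ∈ Ioo 0 T := ⟨hs.trans_le hτ.1, hτ.2.trans_lt ht⟩
        simp only [indicator_of_mem this]
      · intro φ h1 h2 h3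
        rw [← hwy φ h1 h2 h3 η]
        refine integral_congr_ae ?_
        filter_upwards [hby, ae_restrict_mem measurableSet_Ioo] with t h1 h2
        rw [hBe (Ioo_subset_Icc_self h2), h1]
  obtain ⟨B, hBc, hBe, hBy, hB'⟩ := key hb hy' hby hwy
  obtain ⟨C, hCc, hCe, hCp, hC'⟩ := key hc hp' hcp hwp
  have m1 := (memLp_indicator_iff_restrict (f := y) (p := 2) (μ := volume)
    (measurableSet_Ioo (a := 0) (b := T))).2 hy
  have m2 := (memLp_indicator_iff_restrict (f := p) (p := 2) (μ := volume)
    (measurableSet_Ioo (a := 0) (b := T))).2 hp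
  have m3 := (memLp_indicator_iff_restrict (f := y') (p := 2) (μ := volume)
    (measurableSet_Ioo (a := 0) (b := T))).2 hy'
  have m4 := (memLp_indicator_iff_restrict (f := p') (p := 2) (μ := volume)
    (measurableSet_Ioo (a := 0) (b := T))).2 hp'
  set g : ℝ → ℝ := fun t => (Ioo 0 T).indicator y' t ((Ioo 0 T).indicator p t)
    + (Ioo 0 T).indicator p' t ((Ioo 0 T).indicator y t) with hg
  have hgi : Integrable g := (integrable_dual_pairing m3 m2).add (integrable_dual_pairing m4 m1)
  have hgii : ∀ a b, IntervalIntegrable g volume a b := fun a b => hgi.intervalIntegrable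
  -- The formula holds on `[δ, T - δ]`; both sides are continuous in `δ`, which gives the end
  -- points.
  have hin : ∀ᶠ δ in 𝓝[>] (0 : ℝ), inner ℝ (B (T - δ)) (C (T - δ)) - inner ℝ (B δ) (C δ)
      = (∫ t in (0 : ℝ)..T - δ, g t) - ∫ t in (0 : ℝ)..δ, g t := by
    filter_upwards [Ioo_mem_nhdsGT (half_pos hT)] with δ hδ
    have h1 : 0 < δ := hδ.1
    have h2 : δ < T / 2 := hδ.2
    rw [inner_sub_inner_eq_integral hBc hCc m1 m2 m3 m4 hBy hCp hB' hC' h1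
      (by linarith) (by linarith : T - δ < T),
      intervalIntegral.integral_interval_sub_left (hgii _ _) (hgii _ _)]
  have hprim : Continuous fun u => ∫ t in (0 : ℝ)..u, g t :=
    intervalIntegral.continuous_primitive hgii 0
  have hFc : Continuous fun t => inner ℝ (B t) (C t) := hBc.inner hCc
  have c1 : Continuous fun δ : ℝ => inner ℝ (B (T - δ)) (C (T - δ)) - inner ℝ (B δ) (C δ) :=
    (hFc.comp (by fun_prop : Continuous fun δ : ℝ => T - δ)).sub hFc
  have c2 : Continuous fun δ : ℝ => (∫ t in (0 : ℝ)..T - δ, g t) - ∫ t in (0 : ℝ)..δ, g t :=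
    (hprim.comp (by fun_prop : Continuous fun δ : ℝ => T - δ)).sub hprim
  have hlim := tendsto_nhds_unique
    (((c1.tendsto 0).mono_left nhdsWithin_le_nhds).congr' hin)
    ((c2.tendsto 0).mono_left nhdsWithin_le_nhds)
  simp only [sub_zero, intervalIntegral.integral_same] at hlim
  rw [hBe ⟨hT.le, le_rfl⟩, hCe ⟨hT.le, le_rfl⟩, hBe ⟨le_rfl, hT.le⟩, hCe ⟨le_rfl, hT.le⟩] at hlim
  rw [hlim, intervalIntegral.integral_of_le hT.le, integral_Ioc_eq_integral_Ioo,
    ← integral_add (integrable_dual_pairing hy' hp) (integrable_dual_pairing hp' hy)]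
  refine setIntegral_congr_fun measurableSet_Ioo fun t ht => ?_
  simp only [hg, indicator_of_mem ht]

end

/-! ### Square integrable functions of time and duality -/

section

variable {V H : Type*} [NormedAddCommGroup V] [NormedSpace ℝ V] [NormedAddCommGroup H]
  [InnerProductSpace ℝ H]

lemma memLp_sub_apply {V α : Type*} [NormedAddCommGroup V] [MeasurableSpace α] {m : Measure α}
    {p : ℝ≥0∞} {g h : α → V}
    (hg : MemLp g p m) (hh : MemLp h p m) : MemLp (fun t => g t - h t) p m := hg.sub hh

lemma memLp_dual_sub_apply {α : Type*} [MeasurableSpace α] {m : Measure α} {p : ℝ≥0∞}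
    {g h : α → StrongDual ℝ V} (hg : MemLp g p m) (hh : MemLp h p m) :
    MemLp (fun t => g t - h t) p m := hg.sub hh

lemma integral_dual_sub {α : Type*} [MeasurableSpace α] {m : Measure α}
    {g h : α → StrongDual ℝ V} {w : α → V} (hg : MemLp g 2 m) (hh : MemLp h 2 m)
    (hw : MemLp w 2 m) :
    ∫ t, (g t - h t) (w t) ∂m = (∫ t, g t (w t) ∂m) - ∫ t, h t (w t) ∂m := by
  rw [← integral_sub (integrable_dual_pairing hg hw) (integrable_dual_pairing hh hw)]
  rfl

lemma memLp_clm_apply {V' α : Type*} [NormedAddCommGroup V'] [NormedSpace ℝ V']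
    [MeasurableSpace α] {m : Measure α} {p : ℝ≥0∞} (L : V →L[ℝ] V') {g : α → V}
    (hg : MemLp g p m) : MemLp (fun t => L (g t)) p m := L.comp_memLp' hg

lemma integrable_test_mul {T : ℝ} {φ g : ℝ → ℝ} (hφ : Continuous φ)
    (hg : IntegrableOn g (Ioo 0 T)) : IntegrableOn (fun t => φ t * g t) (Ioo 0 T) := by
  have hb : BddAbove ((fun t => ‖φ t‖) '' Icc 0 T) :=
    isCompact_Icc.bddAbove_image hφ.norm.continuousOn
  obtain ⟨C, hC⟩ := hb
  refine Integrable.bdd_mul (c := C) hg hφ.aestronglyMeasurable ?_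
  filter_upwards [ae_restrict_mem measurableSet_Ioo] with t ht
  exact hC ⟨t, Ioo_subset_Icc_self ht, rfl⟩

lemma weak_deriv_sub {T : ℝ} (ι : V →L[ℝ] H) {Y Z : ℝ → V} {Y' Z' : ℝ → StrongDual ℝ V}
    (hYm : MemLp Y 2 (volume.restrict (Ioo 0 T))) (hZm : MemLp Z 2 (volume.restrict (Ioo 0 T)))
    (hYm' : MemLp Y' 2 (volume.restrict (Ioo 0 T)))
    (hZm' : MemLp Z' 2 (volume.restrict (Ioo 0 T))) {φ : ℝ → ℝ} (hφ : ContDiff ℝ ∞ φ) {η : V}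
    (hY : ∫ t in Ioo 0 T, deriv φ t * inner ℝ (ι (Y t)) (ι η) = - ∫ t in Ioo 0 T, φ t * Y' t η)
    (hZ : ∫ t in Ioo 0 T, deriv φ t * inner ℝ (ι (Z t)) (ι η) = - ∫ t in Ioo 0 T, φ t * Z' t η) :
    ∫ t in Ioo 0 T, deriv φ t * inner ℝ (ι (Y t - Z t)) (ι η)
      = - ∫ t in Ioo 0 T, φ t * (Y' t - Z' t) η := by
  have i1 : ∀ {X : ℝ → V}, MemLp X 2 (volume.restrict (Ioo 0 T)) →
      IntegrableOn (fun t => deriv φ t * inner ℝ (ι (X t)) (ι η)) (Ioo 0 T) := fun hX =>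
    integrable_test_mul (hφ.continuous_deriv (by simp))
      (((memLp_clm_apply ι hX).integrable one_le_two).inner_const (ι η))
  have i2 : ∀ {X : ℝ → StrongDual ℝ V}, MemLp X 2 (volume.restrict (Ioo 0 T)) →
      IntegrableOn (fun t => φ t * X t η) (Ioo 0 T) := fun hX =>
    integrable_test_mul hφ.continuous
      ((memLp_clm_apply (ContinuousLinearMap.apply ℝ ℝ η) hX).integrable one_le_two)
  have e1 : ∫ t in Ioo 0 T, deriv φ t * inner ℝ (ι (Y t - Z t)) (ι η)
      = (∫ t in Ioo 0 T, deriv φ t * inner ℝ (ι (Y t)) (ι η))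
        - ∫ t in Ioo 0 T, deriv φ t * inner ℝ (ι (Z t)) (ι η) := by
    rw [← integral_sub (i1 hYm) (i1 hZm)]
    simp_rw [map_sub, inner_sub_left, mul_sub]
  have e2 : ∫ t in Ioo 0 T, φ t * (Y' t - Z' t) η
      = (∫ t in Ioo 0 T, φ t * Y' t η) - ∫ t in Ioo 0 T, φ t * Z' t η := by
    rw [← integral_sub (i2 hYm') (i2 hZm')]
    simp_rw [sub_apply, mul_sub]
  rw [e1, e2, hY, hZ]
  ring

end

/-! ### Sobolev space valued functions of time -/

/-- `val` as a continuous linear map. -/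
def valL {N : ℕ} {q : ℝ≥0∞} [Fact (1 ≤ q)] (Ω : Set (E N)) :
    Sobolev q Ω →L[ℝ] Lp ℝ q (volume.restrict Ω) :=
  (WithLp.fstL q ℝ (Lp ℝ q (volume.restrict Ω)) (Lp (E N) q (volume.restrict Ω))).comp
    (Sobolev q Ω).subtypeL

/-- `grad` as a continuous linear map. -/
def gradL {N : ℕ} {q : ℝ≥0∞} [Fact (1 ≤ q)] (Ω : Set (E N)) :
    Sobolev q Ω →L[ℝ] Lp (E N) q (volume.restrict Ω) :=
  (WithLp.sndL q ℝ (Lp ℝ q (volume.restrict Ω)) (Lp (E N) q (volume.restrict Ω))).comp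
    (Sobolev q Ω).subtypeL

section

variable {N : ℕ} {q : ℝ≥0∞} [Fact (1 ≤ q)] {Ω : Set (E N)}

lemma gradL_apply (f : Sobolev q Ω) : gradL Ω f = grad f := rfl

lemma val_sub (f g : Sobolev q Ω) : val (f - g) = val f - val g := map_sub (valL Ω) f g

lemma grad_sub (f g : Sobolev q Ω) : grad (f - g) = grad f - grad g := map_sub (gradL Ω) f g

lemma volume_restrict_prod (Ω : Set (E N)) (I : Set ℝ) :
    (volume : Measure (E N × ℝ)).restrict (Ω ×ˢ I)
      = (volume.restrict Ω).prod (volume.restrict I) := by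
  rw [Measure.prod_restrict, Measure.volume_eq_prod]

/-- By Tonelli, the `q`-th power integral over the cylinder is the time integral of `‖val (W t)‖ ^
q`. -/
lemma MemBochner.memLp {T : ℝ} (hq : q ≠ ⊤) {W : ℝ → Sobolev q Ω} {w : E N × ℝ → ℝ}
    (h : MemBochner T q W w) : MemLp w q (volume.restrict (Ω ×ˢ Ioo 0 T)) := by
  obtain ⟨hW, hw, hWw⟩ := h
  have hq0 : q ≠ 0 := (zero_lt_one.trans_le (Fact.out : 1 ≤ q)).ne'
  have hqr : 0 < q.toReal := ENNReal.toReal_pos hq0 hq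
  refine ⟨hw, ?_⟩
  rw [eLpNorm_lt_top_iff_lintegral_rpow_enorm_lt_top hq0 hq]
  rw [volume_restrict_prod] at hw ⊢
  rw [lintegral_prod_symm _ (hw.enorm.pow_const _)]
  have hval : MemLp (fun t => val (W t)) q (volume.restrict (Ioo 0 T)) :=
    memLp_clm_apply (valL Ω) hW
  have hfin := (eLpNorm_lt_top_iff_lintegral_rpow_enorm_lt_top hq0 hq).1 hval.2
  refine lt_of_le_of_lt (le_of_eq ?_) hfin
  refine lintegral_congr_ae ?_
  filter_upwards [hWw] with t ht
  rw [Lp.enorm_def, eLpNorm_congr_ae ht, eLpNorm_eq_lintegral_rpow_enorm_toReal hq0 hq,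
    ← ENNReal.rpow_mul, one_div, inv_mul_cancel₀ hqr.ne', ENNReal.rpow_one]

lemma MemBochner.sub {T : ℝ} {a : ℝ≥0∞} {Y Z : ℝ → Sobolev q Ω} {y z : E N × ℝ → ℝ}
    (hY : MemBochner T a Y y) (hZ : MemBochner T a Z z) : MemBochner T a (fun t => Y t - Z t) (y - z) := by
  refine ⟨memLp_sub_apply hY.1 hZ.1, hY.2.1.sub hZ.2.1, ?_⟩
  filter_upwards [hY.2.2, hZ.2.2] with t h1 h2
  rw [val_sub]
  filter_upwards [h1, h2, Lp.coeFn_sub (val (Y t)) (val (Z t))] with x k1 k2 k3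
  rw [k3, Pi.sub_apply, k1, k2, Pi.sub_apply]

lemma IsTimeDeriv.sub {T : ℝ} {Y Z : ℝ → H1 Ω} {Y' Z' : ℝ → StrongDual ℝ (H1 Ω)}
    (hYm : MemLp Y 2 (volume.restrict (Ioo 0 T))) (hZm : MemLp Z 2 (volume.restrict (Ioo 0 T)))
    (hYm' : MemLp Y' 2 (volume.restrict (Ioo 0 T)))
    (hZm' : MemLp Z' 2 (volume.restrict (Ioo 0 T)))
    (hY : IsTimeDeriv T Y Y') (hZ : IsTimeDeriv T Z Z') :
    IsTimeDeriv T (fun t => Y t - Z t) (fun t => Y' t - Z' t) := fun φ h1 h2 h3 η =>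
  weak_deriv_sub (valL Ω) hYm hZm hYm' hZm' h1 (hY φ h1 h2 h3 η) (hZ φ h1 h2 h3 η)

end

/-! ### The data of the control problem -/

namespace Data

variable {N : ℕ} (D : Data N)

/-- On sets of finite measure the control spaces `L^r` and `L^s` embed in `L²`, since both exponents
are at least `2`. -/
instance : IsFiniteMeasure (surface D.Ω) := isFiniteMeasure_surface D.isOpen D.bounded D.boundary

instance : IsFiniteMeasure (volume.restrict D.Ω) :=
  ⟨by rw [Measure.restrict_apply_univ]; exact D.bounded.measure_lt_top⟩

instance : IsFiniteMeasure D.muInt := by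
  rw [Data.muInt, volume_restrict_prod]; infer_instance

lemma two_le_r : 2 ≤ D.r := by
  refine le_trans ?_ D.hr.le
  have h1 : (1 : ℝ≥0∞) ≤ (N : ℝ≥0∞) / 2 := by
    rw [ENNReal.le_div_iff_mul_le (Or.inl two_ne_zero) (Or.inl ENNReal.ofNat_ne_top), one_mul]
    exact_mod_cast (by rcases D.dim with h | h <;> omega : 2 ≤ N)
  calc (2 : ℝ≥0∞) = 1 + 1 := one_add_one_eq_two.symm
    _ ≤ _ := by gcongr

lemma two_le_s : 2 ≤ D.s := by
  refine le_trans ?_ D.hs.le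
  exact_mod_cast (by rcases D.dim with h | h <;> omega : 2 ≤ N + 1)

/-! ### Continuous functions on the cylinder as curves in `L²(Ω)` -/

lemma ext_apply_of_mem (y : C(D.K, ℝ)) {z : E N × ℝ} (hz : z ∈ D.K) : D.ext y z = y ⟨z, hz⟩ :=
  Subtype.val_injective.extend_apply y 0 ⟨z, hz⟩

lemma ext_apply_of_notMem (y : C(D.K, ℝ)) {z : E N × ℝ} (hz : z ∉ D.K) : D.ext y z = 0 :=
  Function.extend_apply' _ _ _ (by rintro ⟨a, rfl⟩; exact hz a.2)

lemma ext_sub (y y' : C(D.K, ℝ)) : D.ext (y - y') = D.ext y - D.ext y' := by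
  funext z
  by_cases hz : z ∈ D.K
  · simp only [Pi.sub_apply, D.ext_apply_of_mem _ hz, ContinuousMap.sub_apply]
  · simp only [Pi.sub_apply, D.ext_apply_of_notMem _ hz, sub_zero]

lemma abs_ext_le (y : C(D.K, ℝ)) (z : E N × ℝ) : |D.ext y z| ≤ ‖y‖ := by
  by_cases hz : z ∈ D.K
  · rw [D.ext_apply_of_mem _ hz]; exact y.norm_coe_le_norm _
  · rw [D.ext_apply_of_notMem _ hz, abs_zero]; exact norm_nonneg _

lemma measurable_ext (y : C(D.K, ℝ)) : Measurable (D.ext y) :=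
  (MeasurableEmbedding.subtype_coe
    (isClosed_closure.measurableSet.prod measurableSet_Icc)).measurable_extend
    y.continuous.measurable measurable_const

lemma memLp_ext (y : C(D.K, ℝ)) (p : ℝ≥0∞) : MemLp (D.ext y) p D.muInt :=
  MemLp.of_bound (D.measurable_ext y).aestronglyMeasurable ‖y‖ (ae_of_all _ (D.abs_ext_le y))

lemma muInt_subset : D.Ω ×ˢ Ioo 0 D.T ⊆ D.K := prod_mono subset_closure Ioo_subset_Icc_self

lemma memLp_ext_slice (y : C(D.K, ℝ)) (t : ℝ) (p : ℝ≥0∞) :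
    MemLp (fun x => D.ext y (x, t)) p (volume.restrict D.Ω) :=
  MemLp.of_bound ((D.measurable_ext y).comp measurable_prodMk_right).aestronglyMeasurable ‖y‖
    (ae_of_all _ fun _ => D.abs_ext_le y _)

/-- The values in time of a function in `C(Ω̄_T)`, as elements of `L²(Ω)`. -/
def slice (y : C(D.K, ℝ)) (t : ℝ) : Lp ℝ 2 (volume.restrict D.Ω) :=
  (D.memLp_ext_slice y t 2).toLp _

lemma coeFn_slice (y : C(D.K, ℝ)) (t : ℝ) :
    D.slice y t =ᵐ[volume.restrict D.Ω] fun x => D.ext y (x, t) := MemLp.coeFn_toLp _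

/-- Uniform continuity on the compact cylinder makes the slices depend continuously on time in the
supremum norm, hence in `L²(Ω)`. This provides the continuous representative of a state. -/
lemma continuousOn_slice (y : C(D.K, ℝ)) : ContinuousOn (D.slice y) (Icc 0 D.T) := by
  -- `M = |Ω|^(1/2)` bounds the `L²` norm by the supremum; dividing by `M + 1` also covers `M = 0`.
  set M : ℝ := (measureUnivNNReal (volume.restrict D.Ω) : ℝ) ^ (2 : ℝ≥0∞).toReal⁻¹ with hM
  have hM0 : 0 ≤ M := by positivity
  have huc : UniformContinuous y := CompactSpace.uniformContinuous_of_continuous y.continuous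
  rw [Metric.continuousOn_iff]
  intro t ht ε hε
  obtain ⟨δ, hδ, h⟩ := Metric.uniformContinuous_iff.1 huc (ε / (M + 1)) (by positivity)
  refine ⟨δ, hδ, fun s hs hst => ?_⟩
  rw [dist_eq_norm]
  refine (Lp.norm_le_of_ae_bound (C := ε / (M + 1)) (by positivity) ?_).trans_lt ?_
  · filter_upwards [Lp.coeFn_sub (D.slice y s) (D.slice y t), D.coeFn_slice y s,
      D.coeFn_slice y t, ae_restrict_mem D.isOpen.measurableSet] with x h1 h2 h3 hx
    have m1 : (x, s) ∈ D.K := ⟨subset_closure hx, hs⟩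
    have m2 : (x, t) ∈ D.K := ⟨subset_closure hx, ht⟩
    rw [h1, Pi.sub_apply, h2, h3, D.ext_apply_of_mem _ m1, D.ext_apply_of_mem _ m2,
      ← dist_eq_norm]
    refine (h ?_).le
    rw [Subtype.dist_eq, Prod.dist_eq]
    exact max_lt (by simpa using hδ) hst
  · rw [← hM, ← mul_div_assoc, div_lt_iff₀ (by positivity)]
    nlinarith

/-! ### The bilinear form of the elliptic operator -/

/-- The bilinear form `form` on `L²(Ω)^N`, as a continuous bilinear map. -/
def formL : Lp (E N) 2 (volume.restrict D.Ω) →L[ℝ] Lp (E N) 2 (volume.restrict D.Ω) →L[ℝ] ℝ :=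
  ∑ i, ∑ j, ((ContinuousLinearMap.lpPairing (volume.restrict D.Ω) 2 2
    (ContinuousLinearMap.mul ℝ ℝ)).bilinearComp
      ((((ContinuousLinearMap.mul ℝ ℝ).holderL (volume.restrict D.Ω) ⊤ 2 2)
        ((D.a_mem i j).toLp _)).comp
        ((EuclideanSpace.proj i : E N →L[ℝ] ℝ).compLpL 2 (volume.restrict D.Ω)))
      ((EuclideanSpace.proj j : E N →L[ℝ] ℝ).compLpL 2 (volume.restrict D.Ω)))

/-- Writing the form as a bounded bilinear map on `L²` yields measurability and integrability in
time when Bochner functions are inserted. -/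
lemma formL_apply (F G : Lp (E N) 2 (volume.restrict D.Ω)) : D.formL F G = D.form F G := by
  have hterm : ∀ i j, Integrable (fun x => D.a i j x * F x i * G x j) (volume.restrict D.Ω) := by
    intro i j
    have hF : MemLp (fun x => F x i) 2 (volume.restrict D.Ω) :=
      (EuclideanSpace.proj i : E N →L[ℝ] ℝ).comp_memLp' (Lp.memLp F)
    have hG : MemLp (fun x => G x j) 2 (volume.restrict D.Ω) :=
      (EuclideanSpace.proj j : E N →L[ℝ] ℝ).comp_memLp' (Lp.memLp G)
    have haF : MemLp (D.a i j * fun x => F x i) 2 (volume.restrict D.Ω) := hF.mul (D.a_mem i j)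
    exact haF.integrable_mul hG
  rw [Data.form, integral_finsetSum _ fun i _ => integrable_finsetSum _ fun j _ => hterm i j]
  simp_rw [integral_finsetSum _ fun j _ => hterm _ j]
  simp only [formL, _root_.sum_apply, ContinuousLinearMap.bilinearComp_apply,
    ContinuousLinearMap.lpPairing_eq_integral]
  refine Finset.sum_congr rfl fun i _ => Finset.sum_congr rfl fun j _ => ?_
  refine integral_congr_ae ?_
  filter_upwards [ContinuousLinearMap.coeFn_holder (r := 2) (ContinuousLinearMap.mul ℝ ℝ)
      ((D.a_mem i j).toLp _) ((EuclideanSpace.proj i : E N →L[ℝ] ℝ).compLp F),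
    (D.a_mem i j).coeFn_toLp,
    (EuclideanSpace.proj i : E N →L[ℝ] ℝ).coeFn_compLp F,
    (EuclideanSpace.proj j : E N →L[ℝ] ℝ).coeFn_compLp G] with x h1 h2 h3 h4
  refine (congrArg₂ (· * ·) h1 h4).trans ?_
  rw [h2, h3]
  rfl

lemma form_comm (F G : E N → E N) : D.form F G = D.form G F := by
  refine integral_congr_ae ?_
  have hs : ∀ᵐ x ∂volume.restrict D.Ω, ∀ i j, D.a i j x = D.a j i x :=
    ae_all_iff.2 fun i => ae_all_iff.2 fun j => D.a_symm i j
  filter_upwards [hs] with x hx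
  rw [Finset.sum_comm]
  refine Finset.sum_congr rfl fun i _ => Finset.sum_congr rfl fun j _ => ?_
  rw [hx j i]; ring

lemma integrable_form {Y W : ℝ → H1 D.Ω} (hY : MemLp Y 2 (volume.restrict (Ioo 0 D.T)))
    (hW : MemLp W 2 (volume.restrict (Ioo 0 D.T))) :
    IntegrableOn (fun t => D.form (grad (Y t)) (grad (W t))) (Ioo 0 D.T) := by
  have := memLp_one_iff_integrable.1 (D.formL.memLp_of_bilin 1
    (memLp_clm_apply (gradL D.Ω) hY) (memLp_clm_apply (gradL D.Ω) hW))
  simp only [formL_apply, gradL_apply] at this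
  exact this

lemma form_grad_sub (f g h : H1 D.Ω) : D.form (grad (f - g)) (grad h)
    = D.form (grad f) (grad h) - D.form (grad g) (grad h) := by
  simp only [← formL_apply, grad_sub, map_sub, _root_.sub_apply]

/-! ### Superposition of states -/

/-- The equation is linear; square integrability of the data makes every product with a test
function integrable, so that the integrals may be split. -/
lemma IsState.sub {u₁ u₂ v₁ v₂ : E N × ℝ → ℝ} {η₁ η₂ : closure D.Ω → ℝ} {y₁ y₂ : C(D.K, ℝ)}
    (hu₁ : MemLp u₁ 2 D.muInt) (hu₂ : MemLp u₂ 2 D.muInt) (hv₁ : MemLp v₁ 2 D.muLat)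
    (hv₂ : MemLp v₂ 2 D.muLat) (h₁ : D.IsState u₁ v₁ η₁ y₁) (h₂ : D.IsState u₂ v₂ η₂ y₂) :
    D.IsState (u₁ - u₂) (v₁ - v₂) (η₁ - η₂) (y₁ - y₂) := by
  obtain ⟨⟨Y, Y', hY, hYm', hYt, hYe⟩, hi₁⟩ := h₁
  obtain ⟨⟨Z, Z', hZ, hZm', hZt, hZe⟩, hi₂⟩ := h₂
  refine ⟨⟨fun t => Y t - Z t, fun t => Y' t - Z' t, ?_, memLp_dual_sub_apply hYm' hZm', hYt.sub hY.1 hZ.1 hYm' hZm' hZt, ?_⟩, ?_⟩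
  · rw [ext_sub]; exact hY.sub hZ
  · intro W w wΓ hW hwΓ hWt
    have hw : MemLp w 2 D.muInt := hW.memLp ENNReal.ofNat_ne_top
    have k1 := hYe W w wΓ hW hwΓ hWt
    have k2 := hZe W w wΓ hW hwΓ hWt
    have e1 : ∫ t in Ioo 0 D.T, (Y' t - Z' t) (W t)
        = (∫ t in Ioo 0 D.T, Y' t (W t)) - ∫ t in Ioo 0 D.T, Z' t (W t) :=
      integral_dual_sub hYm' hZm' hW.1
    have e2 : ∫ z, (v₁ - v₂) z * wΓ z ∂D.muLat
        = (∫ z, v₁ z * wΓ z ∂D.muLat) - ∫ z, v₂ z * wΓ z ∂D.muLat := by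
      have i1 : Integrable (fun z => v₁ z * wΓ z) D.muLat := hv₁.integrable_mul hwΓ
      have i2 : Integrable (fun z => v₂ z * wΓ z) D.muLat := hv₂.integrable_mul hwΓ
      rw [← integral_sub i1 i2]
      simp_rw [Pi.sub_apply, sub_mul]
    have e3 : ∫ z, (u₁ - u₂) z * w z ∂D.muInt
        = (∫ z, u₁ z * w z ∂D.muInt) - ∫ z, u₂ z * w z ∂D.muInt := by
      have i1 : Integrable (fun z => u₁ z * w z) D.muInt := hu₁.integrable_mul hw
      have i2 : Integrable (fun z => u₂ z * w z) D.muInt := hu₂.integrable_mul hw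
      rw [← integral_sub i1 i2]
      simp_rw [Pi.sub_apply, sub_mul]
    have e4 : ∫ t in Ioo 0 D.T, D.form (grad (Y t - Z t)) (grad (W t))
        = (∫ t in Ioo 0 D.T, D.form (grad (Y t)) (grad (W t)))
          - ∫ t in Ioo 0 D.T, D.form (grad (Z t)) (grad (W t)) := by
      rw [← integral_sub (D.integrable_form hY.1 hW.1) (D.integrable_form hZ.1 hW.1)]
      simp_rw [form_grad_sub]
    rw [e1, e2, e3, e4]
    linarith
  · intro x hx
    rw [ContinuousMap.sub_apply, hi₁ x hx, hi₂ x hx, Pi.sub_apply]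

set_option maxHeartbeats 400000 in
/-- Duality between a state with zero initial value and the adjoint state of a function. -/
lemma IsAdjoint.integral_eq {m : E N × ℝ → ℝ} {pT : E N → ℝ} {p pΓ f g : E N × ℝ → ℝ}
    {z : C(D.K, ℝ)} (hp : D.IsAdjoint m pT p pΓ) (hz : D.IsState f g (fun _ => 0) z) :
    (∫ ξ, f ξ * p ξ ∂D.muInt) + ∫ ξ, g ξ * pΓ ξ ∂D.muLat
      = (∫ ξ, m ξ * D.ext z ξ ∂D.muInt) + ∫ x in D.Ω, pT x * D.ext z (x, D.T) := by
  obtain ⟨P, P', hP, hpΓ, hPΓ, hPm', hPt, hPe, c, hc, hcP, hcT⟩ := hp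
  obtain ⟨⟨Z, Z', hZ, hZm', hZt, hZe⟩, hz0⟩ := hz
  -- Each equation is tested with the solution of the other one.
  have k1 := hZe P p pΓ hP hpΓ hPΓ
  have k2 := hPe Z (D.ext z) hZ
  have hb : ∀ᵐ t ∂volume.restrict (Ioo 0 D.T), D.slice z t = val (Z t) := by
    filter_upwards [hZ.2.2] with t ht
    exact Lp.ext ((D.coeFn_slice z t).trans ht.symm)
  have k3 := inner_sub_inner_eq_integral_add (ι := val) D.T_pos (D.continuousOn_slice z) hc
    hZ.1 hP.1 hZm' hPm' hb hcP hZt hPt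
  have e0 : D.slice z 0 = 0 := by
    refine Lp.ext ((D.coeFn_slice z 0).trans (EventuallyEq.trans ?_ (Lp.coeFn_zero _ _ _).symm))
    filter_upwards [ae_restrict_mem D.isOpen.measurableSet] with x hx
    have hx0 : (x, (0 : ℝ)) ∈ D.K := ⟨subset_closure hx, le_rfl, D.T_pos.le⟩
    rw [D.ext_apply_of_mem z hx0]
    exact hz0 x (subset_closure hx)
  -- Nothing is known about the adjoint state at time `0`; its contribution vanishes because `z`
  -- starts from zero.
  have e0' : inner ℝ (D.slice z 0) (c 0) = 0 := by rw [e0]; exact inner_zero_left _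
  have eT : inner ℝ (D.slice z D.T) (c D.T) = ∫ x in D.Ω, pT x * D.ext z (x, D.T) := by
    rw [L2.inner_def]
    refine integral_congr_ae ?_
    filter_upwards [D.coeFn_slice z D.T, hcT] with x h1 h2
    rw [h1, h2]
    rfl
  have ef : ∫ t in Ioo 0 D.T, D.form (grad (P t)) (grad (Z t))
      = ∫ t in Ioo 0 D.T, D.form (grad (Z t)) (grad (P t)) := by
    simp_rw [fun t => D.form_comm (grad (P t)) (grad (Z t))]
  rw [ef] at k2
  linarith

end Data

/-! ### The error estimate -/

lemma toReal_eLpNorm_sq {α : Type*} [MeasurableSpace α] {m : Measure α} {f : α → ℝ}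
    (hf : MemLp f 2 m) : (eLpNorm f 2 m).toReal ^ 2 = ∫ x, f x * f x ∂m := by
  rw [← Lp.norm_toLp f hf, ← real_inner_self_eq_norm_sq, L2.inner_def]
  refine integral_congr_ae ?_
  filter_upwards [hf.coeFn_toLp] with x hx
  rw [hx]
  rfl

/-- Two variational inequalities, tested with each other's solution. -/
lemma sq_norm_sub_le_of_variational_ineq {α : Type*} [MeasurableSpace α] {m : Measure α} {c : ℝ}
    {p q u w : α → ℝ} (hu : MemLp u 2 m) (hw : MemLp w 2 m)
    (hp : Integrable (fun x => p x * (u x - w x)) m)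
    (hq : Integrable (fun x => (u x - w x) * q x) m)
    (h₁ : 0 ≤ ∫ x, (p x + c * u x) * (w x - u x) ∂m)
    (h₂ : 0 ≤ ∫ x, (q x + c * w x) * (u x - w x) ∂m) :
    c * (eLpNorm (u - w) 2 m).toReal ^ 2
      ≤ (∫ x, (u x - w x) * q x ∂m) - ∫ x, p x * (u x - w x) ∂m := by
  -- The factor `u - w` is kept throughout, since `p` and `q` are assumed integrable only against
  -- it.
  have hd : MemLp (u - w) 2 m := hu.sub hw
  have hud : Integrable (fun x => u x * (u x - w x)) m := hu.integrable_mul hd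
  have hwd : Integrable (fun x => w x * (u x - w x)) m := hw.integrable_mul hd
  have e1 : ∫ x, (p x + c * u x) * (w x - u x) ∂m
      = -(∫ x, p x * (u x - w x) ∂m) - c * ∫ x, u x * (u x - w x) ∂m := by
    have hp' : Integrable (fun x => -(p x * (u x - w x))) m := hp.neg
    rw [← integral_neg, ← integral_const_mul, ← integral_sub hp' (hud.const_mul c)]
    congr with x
    ring
  have e2 : ∫ x, (q x + c * w x) * (u x - w x) ∂m
      = (∫ x, (u x - w x) * q x ∂m) + c * ∫ x, w x * (u x - w x) ∂m := by
    rw [← integral_const_mul, ← integral_add hq (hwd.const_mul c)]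
    congr with x
    ring
  have e3 : (eLpNorm (u - w) 2 m).toReal ^ 2
      = (∫ x, u x * (u x - w x) ∂m) - ∫ x, w x * (u x - w x) ∂m := by
    rw [toReal_eLpNorm_sq hd, ← integral_sub hud hwd]
    congr with x
    simp only [Pi.sub_apply]
    ring
  rw [e3, mul_sub]
  linarith

namespace Data

variable {N : ℕ} (D : Data N)

/-- A nonnegative functional on `C(Ω̄_T)`, complementary to `y - ψ`, evaluated at `yk - y`. -/
lemma apply_sub_le {μ : StrongDual ℝ C(D.K, ℝ)} {y : C(D.K, ℝ)} (hc : μ (y - D.ψ) = 0)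
    (hn : ∀ φ : C(D.K, ℝ), 0 ≤ φ → 0 ≤ μ φ) (yk : C(D.K, ℝ)) :
    -μ (y - yk) ≤ ‖μ‖ * ‖(yk - D.ψ) ⊔ 0‖ := by
  have h1 : -μ (y - yk) = μ (yk - D.ψ) := by
    have : y - yk = (y - D.ψ) - (yk - D.ψ) := by abel
    rw [this, map_sub, hc]
    ring
  -- A positive functional is monotone, and a function lies below its positive part.
  have h2 : μ (yk - D.ψ) ≤ μ ((yk - D.ψ) ⊔ 0) := by
    have := hn ((yk - D.ψ) ⊔ 0 - (yk - D.ψ)) (sub_nonneg.2 le_sup_left)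
    rw [map_sub] at this
    linarith
  rw [h1]
  exact h2.trans ((le_abs_self _).trans (μ.le_opNorm _))

lemma memLp_mult {ρ : ℝ} {μk : E N × ℝ → ℝ} (hμk : MemLp μk 2 D.muInt) (y : C(D.K, ℝ)) :
    MemLp (D.mult ρ μk y) 2 D.muInt :=
  ((((D.memLp_ext y 2).sub (D.memLp_ext D.ψ 2)).const_mul ρ).add hμk).sup MemLp.zero

/-- The multiplier of the subproblem, tested with the difference of the states. -/
lemma integral_mult_mul_sub_le {ρ : ℝ} {μk mk : E N × ℝ → ℝ} (hμk : MemLp μk 2 D.muInt)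
    {y yk : C(D.K, ℝ)} (hmk : mk =ᵐ[D.muInt] D.mult ρ μk yk)
    (hy : ∀ z : D.K, (z : E N × ℝ) ∈ D.Ω ×ˢ Ioo 0 D.T → y z ≤ D.ψ z) :
    ∫ z, mk z * D.ext (y - yk) z ∂D.muInt
      ≤ |∫ z, mk z * (D.ext D.ψ z - D.ext yk z) ∂D.muInt| := by
  have hm : MemLp mk 2 D.muInt := (memLp_congr_ae hmk).2 (D.memLp_mult hμk yk)
  refine le_trans (integral_mono_ae (hm.integrable_mul (D.memLp_ext _ 2))
    (hm.integrable_mul ((D.memLp_ext D.ψ 2).sub (D.memLp_ext yk 2))) ?_) (le_abs_self _)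
  -- Feasibility in the open cylinder suffices, because `muInt` is concentrated there.
  filter_upwards [hmk, ae_restrict_mem (D.isOpen.measurableSet.prod measurableSet_Ioo)]
    with z h1 h2
  have hz := D.muInt_subset h2
  have h3 : 0 ≤ mk z := by rw [h1]; exact le_max_right _ _
  refine mul_le_mul_of_nonneg_left ?_ h3
  rw [Pi.sub_apply, D.ext_apply_of_mem _ hz, D.ext_apply_of_mem _ hz, D.ext_apply_of_mem _ hz,
    ContinuousMap.sub_apply]
  exact sub_le_sub_right (hy ⟨z, hz⟩ h2) _

/-- The terminal values of the two adjoint states differ by a monotone term. -/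
lemma integral_terminal_le (y yk : C(D.K, ℝ)) :
    ∫ x in D.Ω, (D.ext yk (x, D.T) - D.yd x) * D.ext (y - yk) (x, D.T)
      ≤ ∫ x in D.Ω, (D.ext y (x, D.T) - D.yd x) * D.ext (y - yk) (x, D.T) := by
  have hi : ∀ w : C(D.K, ℝ), Integrable
      (fun x => (D.ext w (x, D.T) - D.yd x) * D.ext (y - yk) (x, D.T)) (volume.restrict D.Ω) :=
    fun w => ((D.memLp_ext_slice w D.T 2).sub D.yd_mem).integrable_mul
      (D.memLp_ext_slice (y - yk) D.T 2)
  -- The integrands differ by the square `(y - yk)²` at time `T`.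
  refine integral_mono (hi yk) (hi y) fun x => ?_
  simp only [ext_sub, Pi.sub_apply]
  nlinarith [sq_nonneg (D.ext y (x, D.T) - D.ext yk (x, D.T))]

end Data

end ParabolicControl

end

theorem lemma3p4 {N : ℕ} (D : ParabolicControl.Data N)
    (y : C(D.K, ℝ)) (u v : ParabolicControl.E N × ℝ → ℝ) (μ : StrongDual ℝ C(D.K, ℝ))
    (hKKT : D.SolvesKKT y u v μ)
    (ρ : ℝ) (hρ : 0 < ρ) (μk : ParabolicControl.E N × ℝ → ℝ) (hμk : MemLp μk 2 D.muInt)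
    (hμk_nonneg : ∀ᵐ z ∂D.muInt, 0 ≤ μk z)
    (yk : C(D.K, ℝ)) (uk vk mk : ParabolicControl.E N × ℝ → ℝ)
    (hAL : D.SolvesAL ρ μk yk uk vk mk) :
    MemLp (u - uk) 2 D.muInt ∧ MemLp (v - vk) 2 D.muLat ∧
    D.α * (eLpNorm (u - uk) 2 D.muInt).toReal ^ 2 + D.β * (eLpNorm (v - vk) 2 D.muLat).toReal ^ 2
      ≤ ‖μ‖ * ‖(yk - D.ψ) ⊔ 0‖ + |∫ z, mk z * (D.ext D.ψ z - D.ext yk z) ∂D.muInt| := by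
  obtain ⟨p, pΓ, ⟨q, _, _, _, hp, hpΓ, _, hGreen⟩, hVu, hVv⟩ := hKKT.adjoint
  obtain ⟨pk, pkΓ, hadj, hVuk, hVvk⟩ := hAL.adjoint
  have hu : MemLp u 2 D.muInt := hKKT.u_mem.1.mono_exponent D.two_le_r
  have huk : MemLp uk 2 D.muInt := hAL.u_mem.1.mono_exponent D.two_le_r
  have hv : MemLp v 2 D.muLat := hKKT.v_mem.1.mono_exponent D.two_le_s
  have hvk : MemLp vk 2 D.muLat := hAL.v_mem.1.mono_exponent D.two_le_s
  refine ⟨hu.sub huk, hv.sub hvk, ?_⟩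
  have hz : D.IsState (u - uk) (v - vk) (fun _ => 0) (y - yk) := by
    have := hKKT.state.sub D hu huk hv hvk hAL.state
    rwa [sub_self] at this
  have hpk : MemLp pk 2 D.muInt := by
    obtain ⟨P, _, hP, _⟩ := hadj
    exact hP.memLp ENNReal.ofNat_ne_top
  have hpkΓ : MemLp pkΓ 2 D.muLat := by
    obtain ⟨_, _, _, h, _⟩ := hadj
    exact h
  have hdu : MemLp (u - uk) D.r D.muInt := hKKT.u_mem.1.sub hAL.u_mem.1
  have hdv : MemLp (v - vk) D.s D.muLat := hKKT.v_mem.1.sub hAL.v_mem.1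
  have : D.r.HolderConjugate D.r.conjExponent :=
    ENNReal.HolderConjugate.conjExponent (one_le_two.trans D.two_le_r)
  have : D.s.HolderConjugate D.s.conjExponent :=
    ENNReal.HolderConjugate.conjExponent (one_le_two.trans D.two_le_s)
  -- The adjoint state of the measure lies only in the conjugate spaces, so it is paired with
  -- control differences in `L^r` and `L^s`; for `pk` the pairing is in `L²`.
  have ip : Integrable (fun z => p z * (u z - uk z)) D.muInt := hp.integrable_mul hdu
  have ipΓ : Integrable (fun z => pΓ z * (v z - vk z)) D.muLat := hpΓ.integrable_mul hdv
  have ipk : Integrable (fun z => (u z - uk z) * pk z) D.muInt := (hu.sub huk).integrable_mul hpk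
  have ipkΓ : Integrable (fun z => (v z - vk z) * pkΓ z) D.muLat :=
    (hv.sub hvk).integrable_mul hpkΓ
  have k1 := ParabolicControl.sq_norm_sub_le_of_variational_ineq hu huk ip ipk
    (hVu uk hAL.u_mem) (hVuk u hKKT.u_mem)
  have k2 := ParabolicControl.sq_norm_sub_le_of_variational_ineq hv hvk ipΓ ipkΓ
    (hVv vk hAL.v_mem) (hVvk v hKKT.v_mem)
  -- Both adjoint states are paired with the same state `y - yk`; subtracting `g1` from `g2`
  -- rewrites the right sides of `k1` and `k2` as the multiplier and terminal terms bounded by `t1`,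
  -- `t2` and `t3`.
  have g1 := hGreen (u - uk) (v - vk) (y - yk) hdu hdv hz
  have g2 := hadj.integral_eq D hz
  have t1 := D.integral_terminal_le y yk
  have t2 := D.integral_mult_mul_sub_le hμk hAL.mult_eq hKKT.feasible
  have t3 := D.apply_sub_le hKKT.complementarity hKKT.nonneg yk
  simp only [Pi.sub_apply] at g1 g2
  linarith
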